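/- **Setting.** Let $d\in\{2,3\}$, let $\Omega\subset\mathbb R^d$ be a bounded polytopal Lipschitz domain, $\alpha,\tau>0$, $m^0\in H^1(\Omega;\mathbb R^3)$ with $|m^0|=1$ a.e., and $v^0\in L^2(\Omega;\mathbb R^3)$ with $m^0\cdot v^0=0$ a.e. Let $\mathcal T_h$ be a conforming simplicial mesh of $\Omega$ with vertex set $\mathcal N_h$, put $h=\max_{K}\operatorname{diam}K$ and $h_{\min}=\min_{K}\operatorname{diam}K$, and call $\mathcal T_h$ $\kappa$-shape-regular if every element $K$ contains a ball of diameter at least $\operatorname{diam}(K)/\kappa$. Let $S_h$ be the space of continuous, piecewise affine functions on $\overline\Omega$, $\mathcal I_h$ the nodal interpolant (applied componentwise to vector fields), $(\psi,\phi)_h=\int_\Omega \mathcal I_h[\psi\cdot\phi]$ the mass-lumped product and $\|\cdot\|_h$ the induced norm. For $u\in S_h^3$ let $P_hh_{\rm eff}[u]\in S_h^3$ be defined by $(P_hh_{\rm eff}[u],\phi)_h=-(\nabla u,\nabla\phi)_{L^2(\Omega)}$ for all $\phi\in S_h^3$. **Linearized angular momentum method** (time step $k>0$, tolerance $\varepsilon>0$).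 Input: $m_h^0,v_h^0\in S_h^3$ with $|m_h^0(z)|=1$ and $m_h^0(z)\cdot v_h^0(z)=0$ for all $z\in\mathcal N_h$. Set $w_h^0=\mathcal I_h[m_h^0\times v_h^0]$. For $i=0,1,2,\dots$: let $u^{i,0}=m_h^i$, $z^{i,0}=w_h^i$ and, for $\ell=0,1,\dots$, compute $u^{i,\ell+1},z^{i,\ell+1}\in S_h^3$ such that, for all $\phi,\psi\in S_h^3$, $$2(u^{i,\ell+1},\phi)_h+k(u^{i,\ell+1}\times z^{i,\ell},\phi)_h=2(m_h^i,\phi)_h,$$ $$2\tau(z^{i,\ell+1},\psi)_h+k(u^{i,\ell+1}\times z^{i,\ell+1},\psi)_h=k(u^{i,\ell+1}\times P_hh_{\rm eff}[u^{i,\ell+1}],\psi)_h+2\alpha(u^{i,\ell+1}\times m_h^i,\psi)_h+2\tau(w_h^i,\psi)_h,$$ until $\|u^{i,\ell+1}-u^{i,\ell}\|_h+\|z^{i,\ell+1}-z^{i,\ell}\|_h\le\varepsilon$; with $\ell_i$ the smallest $\ell$ for which this holds, set $m_h^{i+1}=2u^{i,\ell_i+1}-m_h^i$, $w_h^{i+1}=2z^{i,\ell_i+1}-w_h^i$,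 and write $d_tm_h^{i+1}=(m_h^{i+1}-m_h^i)/k$. **Proposition 5.1.** Let $\kappa,M\in\mathbb R$. There are $C,k_0,\varepsilon_0>0$, depending only on $d,\Omega,\alpha,\tau,m^0,v^0,\kappa,M$, such that for every function $\rho$ with $\rho(s)\to0$ as $s\to0^+$ there is $h_0>0$ (depending in addition only on $\rho$) with the following property. Let $\mathcal T_h$ be a $\kappa$-shape-regular mesh with $h<h_0$, let $m_h^0,v_h^0$ be admissible input with $$\|m_h^0-m^0\|_{H^1(\Omega)}\le\rho(h),\qquad \|v_h^0-v^0\|_{L^2(\Omega)}\le\rho(h),$$ and let $0<k<k_0$, $0<\varepsilon<\varepsilon_0$, $\varepsilon\le M h_{\min}$. Then, for every $j\in\mathbb N_0$ such that the method completes $j$ time steps, $$\|\nabla m_h^j\|_{L^2(\Omega)}^2+\|w_h^j\|_h^2+k\sum_{i=0}^{j-1}\|d_tm_h^{i+1}\|_h^2\le C\,(1+jk)\exp(jk).$$ -/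

import Mathlib

open MeasureTheory Filter Topology
open scoped RealInnerProductSpace ContDiff

noncomputable section

namespace ILLG

/-- Euclidean space of dimension `d`. -/
abbrev Rd (d : ℕ) := EuclideanSpace ℝ (Fin d)

/-- The target space of magnetizations. -/
abbrev R3 := EuclideanSpace ℝ (Fin 3)

/-- The vector product of three-dimensional Euclidean space. -/
def cross (a b : R3) : R3 := WithLp.toLp 2 (crossProduct a.ofLp b.ofLp)

/-- A bounded Lipschitz domain: bounded, open, connected, nonempty, and in a neighbourhood of each
boundary point it is the set of points above the graph of a Lipschitz function in suitable Cartesian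
coordinates. Here `e` is the vertical unit vector of these coordinates and `y - ⟪e, y⟫ • e` the
horizontal part of `y`. -/
structure IsLipschitzDomain {d : ℕ} (Ω : Set (Rd d)) : Prop where
  isOpen : IsOpen Ω
  isConnected : IsConnected Ω
  isBounded : Bornology.IsBounded Ω
  boundary : ∀ x ∈ frontier Ω, ∃ (r : ℝ) (e : Rd d) (L : NNReal) (γ : Rd d → ℝ),
    0 < r ∧ ‖e‖ = 1 ∧ LipschitzWith L γ ∧
    Ω ∩ Metric.ball x r = {y ∈ Metric.ball x r | γ (y - ⟪e, y⟫ • e) < ⟪e, y⟫}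

/-! ### Functions on the domain -/

/-- The `a`-th partial derivative. -/
def pd {d : ℕ} (a : Fin d) (f : Rd d → R3) (x : Rd d) : R3 :=
  fderiv ℝ f x (EuclideanSpace.single a 1)

/-- `m` is in `H¹(Ω; ℝ³)`, with weak partial derivatives `G a`. -/
structure IsH1 {d : ℕ} (Ω : Set (Rd d)) (m : Rd d → R3) (G : Fin d → Rd d → R3) : Prop where
  memLp : MemLp m 2 (volume.restrict Ω)
  memLp_grad : ∀ a, MemLp (G a) 2 (volume.restrict Ω)
  weak : ∀ φ : Rd d → ℝ, ContDiff ℝ ∞ φ → HasCompactSupport φ → tsupport φ ⊆ Ω → ∀ a,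
    ∫ x in Ω, fderiv ℝ φ x (EuclideanSpace.single a 1) • m x = - ∫ x in Ω, φ x • G a x

/-- The norm of `L²(Ω; ℝ³)`. -/
def l2Norm {d : ℕ} (Ω : Set (Rd d)) (f : Rd d → R3) : ℝ :=
  Real.sqrt (∫ x in Ω, ‖f x‖ ^ 2)

/-- The scalar product of the gradients in `L²(Ω; ℝ^{3×d})`. It is only used for continuous
piecewise affine functions, whose weak gradient is their classical gradient, which exists
everywhere but on the boundaries of the mesh elements, a null set. -/
def gradInner {d : ℕ} (Ω : Set (Rd d)) (u v : Rd d → R3) : ℝ :=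
  ∫ x in Ω, ∑ a, ⟪pd a u x, pd a v x⟫

/-- The norm of the gradient in `L²(Ω; ℝ^{3×d})`, for continuous piecewise affine functions. -/
def gradNorm {d : ℕ} (Ω : Set (Rd d)) (u : Rd d → R3) : ℝ :=
  Real.sqrt (gradInner Ω u u)

/-- The distance in `H¹(Ω; ℝ³)` of the continuous piecewise affine function `u` to the function `m`
with weak partial derivatives `G a`. -/
def h1Dist {d : ℕ} (Ω : Set (Rd d)) (u m : Rd d → R3) (G : Fin d → Rd d → R3) : ℝ :=
  Real.sqrt (l2Norm Ω (u - m) ^ 2 + ∑ a, l2Norm Ω (pd a u - G a) ^ 2)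

/-! ### Meshes -/

/-- A conforming mesh of `Ω` by simplices (triangles for `d = 2`, tetrahedra for `d = 3`): a finite
simplicial complex whose underlying space is the closure of `Ω` and in which every face is a face
of a simplex of full dimension. Faces are given by their finite sets of vertices. -/
structure Mesh {d : ℕ} (Ω : Set (Rd d)) extends Geometry.SimplicialComplex ℝ (Rd d) where
  finite : faces.Finite
  pure : ∀ s ∈ faces, ∃ t ∈ faces, s ⊆ t ∧ t.card = d + 1
  space_eq : toSimplicialComplex.space = closure Ω

namespace Mesh

variable {d : ℕ} {Ω : Set (Rd d)} (T : Mesh Ω)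

/-- The vertex sets of the elements of the mesh. The elements are the convex hulls of these. -/
def cells : Set (Finset (Rd d)) := {s ∈ T.faces | s.card = d + 1}

/-- The mesh size `h`, the maximal diameter of an element (the set of elements is finite). -/
def h : ℝ := sSup ((fun s : Finset (Rd d) => Metric.diam (convexHull ℝ (s : Set (Rd d)))) '' T.cells)

/-- The minimal diameter `hmin` of an element. -/
def hmin : ℝ :=
  sInf ((fun s : Finset (Rd d) => Metric.diam (convexHull ℝ (s : Set (Rd d)))) '' T.cells)

/-- Shape regularity with parameter `κ`: each element `K` contains a ball whose diameter
is at least `diam K / κ`. -/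
def ShapeRegular (κ : ℝ) : Prop :=
  ∀ s ∈ T.cells, ∃ (x : Rd d) (r : ℝ), 0 < r ∧
    Metric.closedBall x r ⊆ convexHull ℝ (s : Set (Rd d)) ∧
    Metric.diam (convexHull ℝ (s : Set (Rd d))) ≤ κ * (2 * r)

theorem finite_vertices : T.vertices.Finite :=
  T.finite.preimage (f := fun x : Rd d => ({x} : Finset (Rd d)))
    (Finset.singleton_injective.injOn)

/-- The finite set of the vertices (nodes) of the mesh. -/
def nodes : Finset (Rd d) := T.finite_vertices.toFinset

/-- The space of continuous functions on the closure of `Ω` whose restriction to each element is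
affine, with values in `V`. Functions on the closure of `Ω` are represented by their extension
by zero, so that two elements of the space are equal if they agree on the closure of `Ω`. -/
def S1 (V : Type*) [NormedAddCommGroup V] [NormedSpace ℝ V] : Submodule ℝ (Rd d → V) where
  carrier := {v | ContinuousOn v (closure Ω) ∧
    (∀ s ∈ T.cells, ∃ A : Rd d →ᵃ[ℝ] V, Set.EqOn v A (convexHull ℝ (s : Set (Rd d)))) ∧
    ∀ x ∉ closure Ω, v x = 0}
  add_mem' := by
    rintro u v ⟨hu, hu', hu''⟩ ⟨hv, hv', hv''⟩
    refine ⟨hu.add hv, fun s hs => ?_, fun x hx => by simp [hu'' x hx, hv'' x hx]⟩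
    obtain ⟨A, hA⟩ := hu' s hs
    obtain ⟨B, hB⟩ := hv' s hs
    exact ⟨A + B, fun x hx => by simp [hA hx, hB hx]⟩
  zero_mem' := ⟨continuousOn_const, fun s _ => ⟨0, fun x _ => by simp⟩, fun x _ => rfl⟩
  smul_mem' := by
    rintro c u ⟨hu, hu', hu''⟩
    refine ⟨hu.const_smul c, fun s hs => ?_, fun x hx => by simp [hu'' x hx]⟩
    obtain ⟨A, hA⟩ := hu' s hs
    exact ⟨c • A, fun x hx => by simp [hA hx]⟩

theorem subset_closure_of_cell {s : Finset (Rd d)} (hs : s ∈ T.cells) :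
    convexHull ℝ (s : Set (Rd d)) ⊆ closure Ω := by
  rw [← T.space_eq]
  exact T.convexHull_subset_space hs.1

theorem exists_cell {x : Rd d} (hx : x ∈ closure Ω) :
    ∃ s ∈ T.cells, x ∈ convexHull ℝ (s : Set (Rd d)) := by
  rw [← T.space_eq, Geometry.SimplicialComplex.mem_space_iff] at hx
  obtain ⟨s, hs, hx⟩ := hx
  obtain ⟨t, ht, hst, hc⟩ := T.pure s hs
  exact ⟨t, ⟨ht, hc⟩, convexHull_mono (by exact_mod_cast hst) hx⟩

theorem mem_nodes_of_cell {s : Finset (Rd d)} (hs : s ∈ T.cells) {z : Rd d} (hz : z ∈ s) :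
    z ∈ T.nodes := by
  simp only [nodes, Set.Finite.mem_toFinset]
  exact T.down_closed hs.1 (Finset.singleton_subset_iff.2 hz) (Finset.singleton_nonempty z)

/-- Two affine maps that agree at the common vertices of two elements agree on the intersection of
these elements. -/
theorem eqOn_inter {s t : Finset (Rd d)} (hs : s ∈ T.cells) (ht : t ∈ T.cells)
    {V : Type*} [AddCommGroup V] [Module ℝ V] {A B : Rd d →ᵃ[ℝ] V}
    (hAB : ∀ z ∈ s, z ∈ t → A z = B z) {x : Rd d} (hxs : x ∈ convexHull ℝ (s : Set (Rd d)))
    (hxt : x ∈ convexHull ℝ (t : Set (Rd d))) : A x = B x := by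
  have hx := T.inter_subset_convexHull hs.1 ht.1 ⟨hxs, hxt⟩
  exact AffineMap.eqOn_affineSpan (s := (s ∩ t : Set (Rd d)))
    (fun z hz => hAB z (by simpa using hz.1) (by simpa using hz.2))
    (convexHull_subset_affineSpan _ hx)

/-- On each element there is an affine function with value `1` at `z` and `0` at the other
vertices of the element. -/
theorem exists_affine {s : Finset (Rd d)} (hs : s ∈ T.cells) (z : Rd d) :
    ∃ A : Rd d →ᵃ[ℝ] ℝ, ∀ y ∈ s, A y = if y = z then 1 else 0 := by
  classical
  have hi := T.indep hs.1
  have htop : affineSpan ℝ (Set.range ((↑) : s → Rd d)) = ⊤ := by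
    rw [hi.affineSpan_eq_top_iff_card_eq_finrank_add_one]
    simpa using hs.2
  let b : AffineBasis s ℝ (Rd d) := ⟨(↑), hi, htop⟩
  by_cases hz : z ∈ s
  · refine ⟨b.coord ⟨z, hz⟩, fun y hy => ?_⟩
    have h1 : b.coord ⟨z, hz⟩ y = _ := b.coord_apply ⟨z, hz⟩ ⟨y, hy⟩
    rw [h1]
    simp [Subtype.ext_iff, eq_comm]
  · refine ⟨0, fun y hy => ?_⟩
    rw [if_neg (by rintro rfl; exact hz hy)]
    rfl

theorem exists_hat (z : Rd d) :
    ∃ φ ∈ T.S1 ℝ, ∀ y ∈ T.nodes, φ y = if y = z then 1 else 0 := by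
  classical
  choose! A hA using fun (s : Finset (Rd d)) (hs : s ∈ T.cells) => T.exists_affine hs z
  choose! c hc hxc using fun (x : Rd d) (hx : x ∈ closure Ω) => T.exists_cell hx
  let φ : Rd d → ℝ := fun x => if x ∈ closure Ω then A (c x) x else 0
  have hφ : ∀ s ∈ T.cells, Set.EqOn φ (A s) (convexHull ℝ (s : Set (Rd d))) := by
    intro s hs x hx
    have hx' := T.subset_closure_of_cell hs hx
    simp only [φ, if_pos hx']
    exact T.eqOn_inter (hc x hx') hs
      (fun y hy hy' => by rw [hA _ (hc x hx') y hy, hA s hs y hy']) (hxc x hx') hx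
  have hfin : Finite T.cells := (T.finite.subset (Set.sep_subset _ _)).to_subtype
  have hcl : (⋃ s : T.cells, convexHull ℝ ((s : Finset (Rd d)) : Set (Rd d))) = closure Ω := by
    apply Set.Subset.antisymm
    · exact Set.iUnion_subset fun s => T.subset_closure_of_cell s.2
    · intro x hx
      obtain ⟨s, hs, hxs⟩ := T.exists_cell hx
      exact Set.mem_iUnion.2 ⟨⟨s, hs⟩, hxs⟩
  refine ⟨φ, ⟨?_, fun s hs => ⟨A s, hφ s hs⟩, fun x hx => if_neg hx⟩, fun y hy => ?_⟩
  · rw [← hcl]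
    refine (locallyFinite_of_finite _).continuousOn_iUnion
      (fun s => (s.1.finite_toSet.isClosed_convexHull ℝ)) fun s => ?_
    exact ((A s).continuous_of_finiteDimensional.continuousOn).congr (hφ s s.2)
  · have hy' : y ∈ T.vertices := by simpa [nodes] using hy
    obtain ⟨s, hs, hys, hcs⟩ := T.pure _ hy'
    have hys' : y ∈ s := hys (Finset.mem_singleton_self y)
    rw [hφ s ⟨hs, hcs⟩ (subset_convexHull ℝ _ (by exact_mod_cast hys')), hA s ⟨hs, hcs⟩ y hys']

/-- The nodal hat function of the node `z`: the element of the space of continuous piecewise affine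
functions with value `1` at `z` and `0` at all other nodes. -/
def hat (z : Rd d) : Rd d → ℝ := (T.exists_hat z).choose

theorem hat_mem (z : Rd d) : T.hat z ∈ T.S1 ℝ := (T.exists_hat z).choose_spec.1

theorem hat_apply (z : Rd d) {y : Rd d} (hy : y ∈ T.nodes) :
    T.hat z y = if y = z then 1 else 0 := (T.exists_hat z).choose_spec.2 y hy

/-- A continuous piecewise affine function is determined by its values at the nodes. -/
theorem eq_of_nodes {V : Type*} [NormedAddCommGroup V] [NormedSpace ℝ V] {u v : Rd d → V}
    (hu : u ∈ T.S1 V) (hv : v ∈ T.S1 V) (huv : ∀ z ∈ T.nodes, u z = v z) : u = v := by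
  funext x
  by_cases hx : x ∈ closure Ω
  · obtain ⟨s, hs, hxs⟩ := T.exists_cell hx
    obtain ⟨A, hA⟩ := hu.2.1 s hs
    obtain ⟨B, hB⟩ := hv.2.1 s hs
    rw [hA hxs, hB hxs]
    refine T.eqOn_inter hs hs (fun z hz _ => ?_) hxs hxs
    have hz' := subset_convexHull ℝ (s : Set (Rd d)) (by exact_mod_cast hz : z ∈ (s : Set (Rd d)))
    rw [← hA hz', ← hB hz', huv z (T.mem_nodes_of_cell hs hz)]
  · rw [hu.2.2 x hx, hv.2.2 x hx]

/-- The nodal interpolant `∑_z v(z) φ_z`. -/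
def interp {V : Type*} [NormedAddCommGroup V] [NormedSpace ℝ V] (v : Rd d → V) : Rd d → V :=
  fun x => ∑ z ∈ T.nodes, T.hat z x • v z

/-! ### Mass lumping and the discrete effective field -/

/-- The mass-lumped product: the integral over `Ω` of the nodal interpolant of the pointwise scalar
product. -/
def lump (ψ φ : Rd d → R3) : ℝ :=
  ∫ x in Ω, T.interp (fun y => ⟪ψ y, φ y⟫) x

/-- The norm induced by the mass-lumped product. -/
def lumpNorm (φ : Rd d → R3) : ℝ := Real.sqrt (T.lump φ φ)

/-- `g` is the discrete effective field of `u`, i.e. the image of the functional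
`φ ↦ -(∇u, ∇φ)` under the mass-lumped projection: the element of the space of continuous piecewise
affine functions (unique, since the mass-lumped product is a scalar product there) whose mass-lumped
product with each test function `φ` is the value of the functional at `φ`. -/
def IsDiscreteField (u g : Rd d → R3) : Prop :=
  g ∈ T.S1 R3 ∧ ∀ φ ∈ T.S1 R3, T.lump g φ = - gradInner Ω u φ

/-- The admissible discrete magnetizations. -/
def Adm : Set (Rd d → R3) := {φ | φ ∈ T.S1 R3 ∧ ∀ z ∈ T.nodes, ‖φ z‖ = 1}

/-- The discrete tangent space of `ψ`. -/
def Tangent (ψ : Rd d → R3) : Set (Rd d → R3) :=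
  {φ | φ ∈ T.S1 R3 ∧ ∀ z ∈ T.nodes, ⟪ψ z, φ z⟫ = 0}

/-! ### The linearized angular momentum method -/

/-- The passage from the iterates `(u, z)` to the next iterates `(u', z')` in the linear
fixed-point iteration of a time step, which starts from `(m, w)`. -/
structure InnerStep (α τ k : ℝ) (m w u z u' z' : Rd d → R3) : Prop where
  u_mem : u' ∈ T.S1 R3
  u_eq : ∀ φ ∈ T.S1 R3,
    2 * T.lump u' φ + k * T.lump (fun x => cross (u' x) (z x)) φ = 2 * T.lump m φ
  z_mem : z' ∈ T.S1 R3
  z_eq : ∃ g, T.IsDiscreteField u' g ∧ ∀ ψ ∈ T.S1 R3,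
    2 * τ * T.lump z' ψ + k * T.lump (fun x => cross (u' x) (z' x)) ψ =
      k * T.lump (fun x => cross (u' x) (g x)) ψ
        + 2 * α * T.lump (fun x => cross (u' x) (m x)) ψ + 2 * τ * T.lump w ψ

/-- The stopping criterion for two consecutive iterates `(u, z)` and `(u', z')`. -/
def Stop (ε : ℝ) (u z u' z' : Rd d → R3) : Prop :=
  T.lumpNorm (u' - u) + T.lumpNorm (z' - z) ≤ ε

/-- One time step from `(m, w)` to `(m', w')`: the fixed-point iteration is run until the stopping
criterion is met for the first time, which happens at the iteration number `n`, and the new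
approximations are extrapolated from the last iterates. -/
def TimeStep (α τ k ε : ℝ) (m w m' w' : Rd d → R3) : Prop :=
  ∃ (n : ℕ) (u z : ℕ → Rd d → R3),
    u 0 = m ∧ z 0 = w ∧
    (∀ l ≤ n, T.InnerStep α τ k m w (u l) (z l) (u (l + 1)) (z (l + 1))) ∧
    T.Stop ε (u n) (z n) (u (n + 1)) (z (n + 1)) ∧
    (∀ l < n, ¬ T.Stop ε (u l) (z l) (u (l + 1)) (z (l + 1))) ∧
    m' = (2 : ℝ) • u (n + 1) - m ∧ w' = (2 : ℝ) • z (n + 1) - w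

/-- `(m i, w i)`, `i = 0, …, j`, are the approximations generated by `j` time steps of the
linearized angular momentum method with step size `k` and tolerance `ε`, applied to the admissible
initial magnetization `mh` and the tangential initial velocity `vh`. -/
structure Generates (α τ k ε : ℝ) (mh vh : Rd d → R3) (j : ℕ) (m w : ℕ → Rd d → R3) : Prop where
  adm : mh ∈ T.Adm
  tangent : vh ∈ T.Tangent mh
  m_zero : m 0 = mh
  w_zero : w 0 = T.interp (fun x => cross (mh x) (vh x))
  step : ∀ i < j, T.TimeStep α τ k ε (m i) (w i) (m (i + 1)) (w (i + 1))

end Mesh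

end ILLG

end

open ILLG

/-!
The idea is an energy argument. Write `(m, w)` and `(m', w')` for the values before and after a time
step, `(u, z)` for the last iterates, so that `u` and `z` are the midpoints of `m, m'` and `w, w'`,
and let `δ` be the last increment of the second iterate. The stopping criterion controls `δ` by `ε`
in the mass-lumped norm.

The mass-lumped product is a weighted sum over the nodes with positive weights (`lump_eq_sum`,
`weight_pos`). Hence the first equation holds at every node. There it says that
`d_t m = -u × (z - δ)`, and it yields `|m'| = |m| = 1` and `|u| ≤ 1`
(`InnerStep.norm_extrapolation`, `InnerStep.norm_le`). Testing the second equation with `z` and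
replacing `u × z` by `u × δ - d_t m` gives the energy law `InnerStep.energy_eq`: up to the damping
term, the energy `½ ‖∇m‖² + ½ τ ‖w‖_h²` changes by
`k ((∇u, ∇ I_h[u × δ]) + α (d_t m, u × δ)_h)` only.

The first of these terms requires the inverse estimate `hmin_sq_mul_gradInner_le`, which costs a
factor `1 / hmin`; since `‖δ‖_h ≤ ε ≤ M hmin`, the product is bounded (`TimeStep.energy_le`). The
second one is absorbed in the damping term. A discrete Gronwall inequality (`discrete_gronwall`)
then yields the claim, once the initial energy is bounded; for the kinetic part this needs the
comparison of the mass-lumped norm with the `L²` norm (`lump_self_le`).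

Both finite element estimates are proved element by element. This is possible because the elements
are disjoint up to null sets and fill the domain up to a null set (`setIntegral_eq_sum`). On a
single element a function is large near the vertex where it is largest, more precisely on a
shrunken copy of the element (`le_setIntegral_of_homothety`), and its derivative is bounded by its
difference quotient across an inscribed ball (`norm_pd_le`).
-/

namespace ILLG

/-! ### Lipschitz domains and simplices -/

/-- A Lipschitz domain has no slits: near a boundary point, the points below the graph form
an open set disjoint from the domain, so no boundary point is interior to the closure. -/
theorem IsLipschitzDomain.interior_closure_subset {d : ℕ} {Ω : Set (Rd d)}
    (hΩ : IsLipschitzDomain Ω) : interior (closure Ω) ⊆ Ω := by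
  intro x hx
  by_contra hxΩ
  have hxf : x ∈ frontier Ω := by
    rw [hΩ.isOpen.frontier_eq]
    exact ⟨interior_subset hx, hxΩ⟩
  obtain ⟨r, e, L, γ, hr, he, hγ, hgraph⟩ := hΩ.boundary x hxf
  have hee : ⟪e, e⟫ = (1 : ℝ) := by rw [real_inner_self_eq_norm_sq, he]; norm_num
  have hxγ : ⟪e, x⟫ ≤ γ (x - ⟪e, x⟫ • e) := by
    by_contra! hlt
    exact hxΩ (hgraph.symm.subset ⟨Metric.mem_ball_self hr, hlt⟩).1
  have hcont : Continuous fun t : ℝ => x - t • e := by fun_prop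
  have hev : ∀ᶠ t in 𝓝 (0 : ℝ), x - t • e ∈ interior (closure Ω) ∩ Metric.ball x r := by
    have h0 : x - (0 : ℝ) • e = x := by simp
    refine hcont.continuousAt.eventually ?_
    simp only [h0]
    exact inter_mem (isOpen_interior.mem_nhds hx) (Metric.ball_mem_nhds x hr)
  obtain ⟨t, ⟨htI, htB⟩, ht0⟩ :=
    ((hev.filter_mono nhdsWithin_le_nhds).and (self_mem_nhdsWithin : Set.Ioi (0 : ℝ) ∈ _)).exists
  have ht0' : (0 : ℝ) < t := ht0
  -- The points below the graph form an open set that does not meet `Ω`.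
  have hopen : IsOpen (Metric.ball x r ∩ {y : Rd d | ⟪e, y⟫ < γ (y - ⟪e, y⟫ • e)}) := by
    refine Metric.isOpen_ball.inter (isOpen_lt (by fun_prop) ?_)
    exact hγ.continuous.comp (by fun_prop)
  have hmem : x - t • e ∈ Metric.ball x r ∩ {y : Rd d | ⟪e, y⟫ < γ (y - ⟪e, y⟫ • e)} := by
    refine ⟨htB, ?_⟩
    have h1 : ⟪e, x - t • e⟫ = ⟪e, x⟫ - t := by
      rw [inner_sub_right, real_inner_smul_right, hee, mul_one]
    have h2 : x - t • e - ⟪e, x - t • e⟫ • e = x - ⟪e, x⟫ • e := by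
      rw [h1, sub_smul]; abel
    rw [Set.mem_ofPred_eq, h2, h1]
    linarith
  obtain ⟨y, hy, hyΩ⟩ := mem_closure_iff.1 (interior_subset htI) _ hopen hmem
  have := (hgraph.subset ⟨hyΩ, hy.1⟩).2
  exact absurd hy.2 (not_lt.2 (le_of_lt this))

/-- The simplex with the given vertex set. -/
abbrev simplex {d : ℕ} (s : Finset (Rd d)) : Set (Rd d) := convexHull ℝ (s : Set (Rd d))

section Simplex

variable {d : ℕ} (s : Finset (Rd d))

theorem isCompact_simplex : IsCompact (simplex s) :=
  s.finite_toSet.isCompact_convexHull ℝ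

theorem measurableSet_simplex : MeasurableSet (simplex s) :=
  (isCompact_simplex s).isClosed.measurableSet

theorem volume_simplex_lt_top : volume (simplex s) < ⊤ := (isCompact_simplex s).measure_lt_top

theorem interior_simplex_ae_eq : interior (simplex s) =ᵐ[volume] simplex s := by
  refine interior_ae_eq_of_null_frontier ?_
  exact (convex_convexHull ℝ _).addHaar_frontier volume

theorem ae_simplex_mem_interior :
    ∀ᵐ x ∂(volume.restrict (simplex s)), x ∈ interior (simplex s) := by
  rw [← Measure.restrict_congr_set (interior_simplex_ae_eq s)]
  exact ae_restrict_mem isOpen_interior.measurableSet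

variable {s}

theorem norm_affine_le {V : Type*} [NormedAddCommGroup V] [NormedSpace ℝ V]
    {A : Rd d →ᵃ[ℝ] V} {c : ℝ} (h : ∀ z ∈ s, ‖A z‖ ≤ c) {x : Rd d} (hx : x ∈ simplex s) :
    ‖A x‖ ≤ c := by
  have hconv : Convex ℝ (A ⁻¹' Metric.closedBall 0 c) := (convex_closedBall 0 c).affine_preimage A
  have := convexHull_min (s := (s : Set (Rd d))) (fun z hz => by simpa using h z hz) hconv hx
  simpa using this

theorem affine_nonneg {A : Rd d →ᵃ[ℝ] ℝ} (h : ∀ z ∈ s, 0 ≤ A z) {x : Rd d} (hx : x ∈ simplex s) :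
    0 ≤ A x := by
  have hconv : Convex ℝ (A ⁻¹' Set.Ici 0) := (convex_Ici 0).affine_preimage A
  exact convexHull_min (s := (s : Set (Rd d))) (fun z hz => h z hz) hconv hx

theorem homothety_image_subset {z : Rd d} (hz : z ∈ s) {t : ℝ} (ht0 : 0 ≤ t) (ht1 : t ≤ 1) :
    AffineMap.homothety z t '' simplex s ⊆ simplex s := by
  rintro _ ⟨y, hy, rfl⟩
  rw [AffineMap.homothety_eq_lineMap]
  exact (convex_convexHull ℝ _).lineMap_mem (subset_convexHull ℝ _ hz) hy ⟨ht0, ht1⟩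

theorem affine_homothety {V : Type*} [NormedAddCommGroup V] [NormedSpace ℝ V]
    (A : Rd d →ᵃ[ℝ] V) (z y : Rd d) (t : ℝ) :
    A (AffineMap.homothety z t y) = (1 - t) • A z + t • A y := by
  rw [AffineMap.homothety_eq_lineMap, AffineMap.apply_lineMap, AffineMap.lineMap_apply_module]

/-- A function that is at least `c` on a copy of the simplex shrunk by the factor `t` towards one
of its vertices has integral at least `t ^ d |K| c`. -/
theorem le_setIntegral_of_homothety {f : Rd d → ℝ} (hf : IntegrableOn f (simplex s))
    (hf0 : ∀ x ∈ simplex s, 0 ≤ f x) {z : Rd d} (hz : z ∈ s) {t : ℝ} (ht0 : 0 ≤ t) (ht1 : t ≤ 1)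
    {c : ℝ} (hc : ∀ y ∈ simplex s, c ≤ f (AffineMap.homothety z t y)) :
    t ^ d * (volume.real (simplex s) * c) ≤ ∫ x in simplex s, f x := by
  have hsub := homothety_image_subset hz ht0 ht1
  have hcomp : IsCompact (AffineMap.homothety z t '' simplex s) :=
    (isCompact_simplex s).image (AffineMap.homothety_continuous z t)
  have hvol : volume.real (AffineMap.homothety z t '' simplex s)
      = t ^ d * volume.real (simplex s) := by
    rw [Measure.real, Measure.addHaar_image_homothety, ENNReal.toReal_mul,
      ENNReal.toReal_ofReal (abs_nonneg _), finrank_euclideanSpace_fin,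
      abs_of_nonneg (by positivity)]
    rfl
  calc t ^ d * (volume.real (simplex s) * c)
      = ∫ _ in AffineMap.homothety z t '' simplex s, c := by
        rw [setIntegral_const, hvol, smul_eq_mul, mul_assoc]
    _ ≤ ∫ x in AffineMap.homothety z t '' simplex s, f x := by
        refine setIntegral_mono_on (integrableOn_const hcomp.measure_lt_top.ne) (hf.mono_set hsub)
          hcomp.isClosed.measurableSet ?_
        rintro _ ⟨y, hy, rfl⟩
        exact hc y hy
    _ ≤ ∫ x in simplex s, f x := by
        refine setIntegral_mono_set hf ?_ hsub.eventuallyLE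
        exact (ae_restrict_mem (measurableSet_simplex s)).mono hf0

end Simplex

namespace Mesh

/-! ### Integration over a mesh -/

variable {d : ℕ} {Ω : Set (Rd d)} (T : Mesh Ω)

theorem cells_finite : T.cells.Finite := T.finite.subset (Set.sep_subset _ _)

noncomputable instance : Fintype T.cells := T.cells_finite.fintype

theorem interior_simplex_nonempty {s : Finset (Rd d)} (hs : s ∈ T.cells) :
    (interior (simplex s)).Nonempty := by
  rw [interior_convexHull_nonempty_iff_affineSpan_eq_top]
  have := (T.indep hs.1).affineSpan_eq_top_iff_card_eq_finrank_add_one.2 (by simpa using hs.2)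
  simpa using this

/-- Two elements meet in the convex hull of at most `d` points, hence within a hyperplane. -/
theorem aedisjoint_simplex {s t : Finset (Rd d)} (hs : s ∈ T.cells) (ht : t ∈ T.cells)
    (hst : s ≠ t) : AEDisjoint volume (simplex s) (simplex t) := by
  classical
  have hsub : simplex s ∩ simplex t ⊆ affineSpan ℝ ((s ∩ t : Finset (Rd d)) : Set (Rd d)) := by
    refine (T.inter_subset_convexHull hs.1 ht.1).trans ?_
    rw [Finset.coe_inter]
    exact convexHull_subset_affineSpan _
  refine measure_mono_null hsub (Measure.addHaar_affineSubspace _ _ fun htop => ?_)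
  have hcard : (s ∩ t).card < d + 1 := by
    rw [← hs.2]
    refine Finset.card_lt_card (Finset.inter_subset_left.ssubset_of_ne fun h => hst ?_)
    exact Finset.eq_of_subset_of_card_le (Finset.inter_eq_left.1 h) (by rw [hs.2, ht.2])
  have hI : AffineIndependent ℝ ((↑) : (s ∩ t : Finset (Rd d)) → Rd d) :=
    (T.indep hs.1).mono (s := ((s ∩ t : Finset (Rd d)) : Set (Rd d)))
      (by exact_mod_cast Finset.inter_subset_left)
  have := hI.affineSpan_eq_top_iff_card_eq_finrank_add_one.1
    (by rw [Subtype.range_coe_subtype]; exact htop)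
  rw [finrank_euclideanSpace_fin, Fintype.card_coe] at this
  omega

theorem iUnion_simplex : (⋃ s : T.cells, simplex (s : Finset (Rd d))) = closure Ω := by
  apply Set.Subset.antisymm
  · exact Set.iUnion_subset fun s => T.subset_closure_of_cell s.2
  · intro x hx
    obtain ⟨s, hs, hxs⟩ := T.exists_cell hx
    exact Set.mem_iUnion.2 ⟨⟨s, hs⟩, hxs⟩

/-- The boundary of the domain is covered by the boundaries of the elements, hence a null set. -/
theorem ae_eq_closure (T : Mesh Ω) (hΩ : IsLipschitzDomain Ω) : Ω =ᵐ[volume] closure Ω := by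
  have hfr : frontier Ω ⊆ ⋃ s : T.cells, frontier (simplex (s : Finset (Rd d))) := by
    intro x hx
    have hx' := hx.1
    rw [← T.iUnion_simplex] at hx'
    obtain ⟨s, hs⟩ := Set.mem_iUnion.1 hx'
    refine Set.mem_iUnion.2 ⟨s, subset_closure hs, fun hint => hx.2 ?_⟩
    rw [hΩ.isOpen.interior_eq]
    exact hΩ.interior_closure_subset (interior_mono (T.subset_closure_of_cell s.2) hint)
  have h0 : volume (frontier Ω) = 0 := by
    refine measure_mono_null hfr (measure_iUnion_null fun s => ?_)
    exact (convex_convexHull ℝ _).addHaar_frontier volume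
  exact (closure_ae_eq_of_null_frontier h0).symm

theorem integrableOn_iff (hΩ : IsLipschitzDomain Ω) {V : Type*} [NormedAddCommGroup V]
    {f : Rd d → V} : IntegrableOn f Ω ↔ ∀ s ∈ T.cells, IntegrableOn f (simplex s) := by
  rw [integrableOn_congr_set_ae (T.ae_eq_closure hΩ), ← T.iUnion_simplex,
    integrableOn_finite_iUnion]
  simp

theorem setIntegral_eq_sum (hΩ : IsLipschitzDomain Ω) {V : Type*} [NormedAddCommGroup V]
    [NormedSpace ℝ V] {f : Rd d → V} (hf : ∀ s ∈ T.cells, IntegrableOn f (simplex s)) :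
    ∫ x in Ω, f x = ∑ s : T.cells, ∫ x in simplex (s : Finset (Rd d)), f x := by
  have hΩf := (T.integrableOn_iff hΩ).2 hf
  rw [integrableOn_congr_set_ae (T.ae_eq_closure hΩ), ← T.iUnion_simplex] at hΩf
  rw [setIntegral_congr_set (T.ae_eq_closure hΩ), ← T.iUnion_simplex,
    integral_iUnion_ae (fun s => (measurableSet_simplex _).nullMeasurableSet) ?_ hΩf, tsum_fintype]
  intro s t hst
  exact T.aedisjoint_simplex s.2 t.2 fun h => hst (Subtype.ext h)

theorem ae_of_forall_interior (hΩ : IsLipschitzDomain Ω) {p : Rd d → Prop}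
    (h : ∀ s ∈ T.cells, ∀ x ∈ interior (simplex s), p x) : ∀ᵐ x ∂(volume.restrict Ω), p x := by
  rw [Measure.restrict_congr_set (T.ae_eq_closure hΩ), ← T.iUnion_simplex, ae_restrict_iUnion_iff]
  exact fun s => (ae_simplex_mem_interior _).mono fun x hx => h s s.2 x hx

/-! ### Continuous piecewise affine functions -/

section S1

variable {T} {V : Type*} [NormedAddCommGroup V] [NormedSpace ℝ V]

theorem continuousOn_simplex {u : Rd d → V} (hu : u ∈ T.S1 V) {s : Finset (Rd d)}
    (hs : s ∈ T.cells) : ContinuousOn u (simplex s) := hu.1.mono (T.subset_closure_of_cell hs)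

theorem integrableOn_S1 (hΩ : IsLipschitzDomain Ω) {u : Rd d → V} (hu : u ∈ T.S1 V) :
    IntegrableOn u Ω :=
  (T.integrableOn_iff hΩ).2 fun _ hs =>
    (continuousOn_simplex hu hs).integrableOn_compact (isCompact_simplex _)

theorem norm_le_on_simplex {u : Rd d → V} (hu : u ∈ T.S1 V) {s : Finset (Rd d)}
    (hs : s ∈ T.cells) {c : ℝ} (h : ∀ z ∈ s, ‖u z‖ ≤ c) {x : Rd d} (hx : x ∈ simplex s) :
    ‖u x‖ ≤ c := by
  obtain ⟨A, hA⟩ := hu.2.1 s hs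
  rw [hA hx]
  exact norm_affine_le (fun z hz => by rw [← hA (subset_convexHull ℝ _ hz)]; exact h z hz) hx

theorem nonneg_on_simplex {u : Rd d → ℝ} (hu : u ∈ T.S1 ℝ) {s : Finset (Rd d)}
    (hs : s ∈ T.cells) (h : ∀ z ∈ s, 0 ≤ u z) {x : Rd d} (hx : x ∈ simplex s) :
    0 ≤ u x := by
  obtain ⟨A, hA⟩ := hu.2.1 s hs
  rw [hA hx]
  exact affine_nonneg (fun z hz => by rw [← hA (subset_convexHull ℝ _ hz)]; exact h z hz) hx

theorem S1_homothety {u : Rd d → V} (hu : u ∈ T.S1 V) {s : Finset (Rd d)}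
    (hs : s ∈ T.cells) {z y : Rd d} (hz : z ∈ s) (hy : y ∈ simplex s) {t : ℝ} (ht0 : 0 ≤ t)
    (ht1 : t ≤ 1) : u (AffineMap.homothety z t y) = (1 - t) • u z + t • u y := by
  obtain ⟨A, hA⟩ := hu.2.1 s hs
  rw [hA (homothety_image_subset hz ht0 ht1 ⟨y, hy, rfl⟩), hA hy, hA (subset_convexHull ℝ _ hz),
    affine_homothety]

theorem smul_hat_mem (z : Rd d) (v : V) : (fun x => T.hat z x • v) ∈ T.S1 V := by
  obtain ⟨hc, ha, h0⟩ := T.hat_mem z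
  refine ⟨hc.smul continuousOn_const, fun s hs => ?_, fun x hx => by simp [h0 x hx]⟩
  obtain ⟨A, hA⟩ := ha s hs
  exact ⟨(LinearMap.toSpanSingleton ℝ V v).toAffineMap.comp A, fun x hx => by simp [hA hx]⟩

theorem interp_mem (v : Rd d → V) : T.interp v ∈ T.S1 V := by
  have : T.interp v = ∑ z ∈ T.nodes, fun x => T.hat z x • v z := by
    funext x; simp [interp]
  rw [this]
  exact Submodule.sum_mem _ fun z _ => smul_hat_mem z _

theorem interp_apply (v : Rd d → V) {y : Rd d} (hy : y ∈ T.nodes) : T.interp v y = v y := by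
  classical
  simp only [interp]
  rw [Finset.sum_eq_single_of_mem y hy fun z _ hz => by
    rw [T.hat_apply z hy, if_neg hz.symm, zero_smul]]
  rw [T.hat_apply y hy, if_pos rfl, one_smul]

/-- The integral over an element of a nonnegative continuous piecewise affine function is bounded
below by each of its values at the vertices. -/
theorem le_setIntegral_S1 {q : Rd d → ℝ} (hq : q ∈ T.S1 ℝ) {s : Finset (Rd d)}
    (hs : s ∈ T.cells) (h : ∀ z ∈ s, 0 ≤ q z) {z : Rd d} (hz : z ∈ s) :
    (1 / 2) ^ (d + 1) * (volume.real (simplex s) * q z) ≤ ∫ x in simplex s, q x := by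
  have := le_setIntegral_of_homothety (t := 1 / 2) (c := 1 / 2 * q z)
    ((continuousOn_simplex hq hs).integrableOn_compact (isCompact_simplex _))
    (fun x hx => nonneg_on_simplex hq hs h hx) hz (by norm_num) (by norm_num) (fun y hy => ?_)
  · refine le_trans (le_of_eq ?_) this
    ring
  · rw [S1_homothety hq hs hz hy (by norm_num) (by norm_num)]
    have := nonneg_on_simplex hq hs h hy
    simp only [smul_eq_mul]
    linarith

end S1

theorem nonempty_of_cell {s : Finset (Rd d)} (hs : s ∈ T.cells) : s.Nonempty :=
  Finset.card_pos.1 (by rw [hs.2]; omega)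

theorem volume_simplex_pos {s : Finset (Rd d)} (hs : s ∈ T.cells) :
    0 < volume.real (simplex s) :=
  ENNReal.toReal_pos
    ((isOpen_interior.measure_pos volume (T.interior_simplex_nonempty hs)).trans_le
      (measure_mono interior_subset)).ne' (volume_simplex_lt_top s).ne

theorem exists_cell_of_node {z : Rd d} (hz : z ∈ T.nodes) : ∃ s ∈ T.cells, z ∈ s := by
  have hz' : z ∈ T.vertices := by simpa [nodes] using hz
  obtain ⟨s, hs, hzs, hcs⟩ := T.pure _ hz'
  exact ⟨s, ⟨hs, hcs⟩, hzs (Finset.mem_singleton_self z)⟩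

/-! ### The mass-lumped product -/

/-- The nodal weights of the mass-lumped product. -/
noncomputable def weight (z : Rd d) : ℝ := ∫ x in Ω, T.hat z x

theorem weight_pos (hΩ : IsLipschitzDomain Ω) {z : Rd d} (hz : z ∈ T.nodes) : 0 < T.weight z := by
  classical
  have hhat : ∀ s ∈ T.cells, ∀ y ∈ s, 0 ≤ T.hat z y := fun s hs y hy => by
    rw [T.hat_apply z (T.mem_nodes_of_cell hs hy)]; split_ifs <;> norm_num
  rw [weight, T.setIntegral_eq_sum hΩ fun s hs =>
    (continuousOn_simplex (T.hat_mem z) hs).integrableOn_compact (isCompact_simplex _)]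
  obtain ⟨s, hs, hzs⟩ := T.exists_cell_of_node hz
  refine Finset.sum_pos' (fun t _ => setIntegral_nonneg (measurableSet_simplex _) fun x hx =>
    nonneg_on_simplex (T.hat_mem z) t.2 (hhat t t.2) hx) ⟨⟨s, hs⟩, Finset.mem_univ _, ?_⟩
  refine lt_of_lt_of_le ?_ (le_setIntegral_S1 (T.hat_mem z) hs (hhat s hs) hzs)
  rw [T.hat_apply z hz, if_pos rfl]
  have := T.volume_simplex_pos hs
  positivity

theorem lump_eq_sum (hΩ : IsLipschitzDomain Ω) (ψ φ : Rd d → R3) :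
    T.lump ψ φ = ∑ z ∈ T.nodes, T.weight z * ⟪ψ z, φ z⟫ := by
  simp only [lump, interp, smul_eq_mul]
  rw [integral_finsetSum _ fun z _ => (integrableOn_S1 hΩ (T.hat_mem z)).mul_const _]
  simp only [integral_mul_const, weight]

theorem lump_self_nonneg (hΩ : IsLipschitzDomain Ω) (φ : Rd d → R3) : 0 ≤ T.lump φ φ := by
  rw [T.lump_eq_sum hΩ]
  exact Finset.sum_nonneg fun z hz =>
    mul_nonneg (T.weight_pos hΩ hz).le real_inner_self_nonneg

theorem lumpNorm_sq (hΩ : IsLipschitzDomain Ω) (φ : Rd d → R3) :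
    T.lumpNorm φ ^ 2 = T.lump φ φ := Real.sq_sqrt (T.lump_self_nonneg hΩ φ)

theorem lump_self_mono (hΩ : IsLipschitzDomain Ω) {φ ψ : Rd d → R3}
    (h : ∀ z ∈ T.nodes, ‖φ z‖ ≤ ‖ψ z‖) : T.lump φ φ ≤ T.lump ψ ψ := by
  rw [T.lump_eq_sum hΩ, T.lump_eq_sum hΩ]
  refine Finset.sum_le_sum fun z hz => mul_le_mul_of_nonneg_left ?_ (T.weight_pos hΩ hz).le
  rw [real_inner_self_eq_norm_sq, real_inner_self_eq_norm_sq]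
  gcongr
  exact h z hz

theorem lump_self_eq_sum_setIntegral (hΩ : IsLipschitzDomain Ω) (φ : Rd d → R3) :
    T.lump φ φ = ∑ s : T.cells, ∫ x in simplex (s : Finset (Rd d)),
      T.interp (fun y => ⟪φ y, φ y⟫) x :=
  T.setIntegral_eq_sum hΩ fun _ hs =>
    (continuousOn_simplex (interp_mem _) hs).integrableOn_compact (isCompact_simplex _)

/-- The mass-lumped norm of a continuous piecewise affine function is bounded by its `L²` norm. -/
theorem lump_self_le (hΩ : IsLipschitzDomain Ω) {φ : Rd d → R3} (hφ : φ ∈ T.S1 R3) :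
    T.lump φ φ ≤ 4 ^ (d + 1) * l2Norm Ω φ ^ 2 := by
  have hint : ∀ s ∈ T.cells, IntegrableOn (fun x => ‖φ x‖ ^ 2) (simplex s) := fun s hs =>
    ((continuousOn_simplex hφ hs).norm.pow 2).integrableOn_compact (isCompact_simplex _)
  rw [l2Norm, Real.sq_sqrt (integral_nonneg fun x => by positivity),
    T.lump_self_eq_sum_setIntegral hΩ, T.setIntegral_eq_sum hΩ hint, Finset.mul_sum]
  refine Finset.sum_le_sum ?_
  rintro ⟨s, hs⟩ -
  obtain ⟨z, hz, hmax⟩ := s.exists_max_image (fun z => ‖φ z‖) (T.nonempty_of_cell hs)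
  have hup : ∫ x in simplex s, T.interp (fun y => ⟪φ y, φ y⟫) x
      ≤ ‖φ z‖ ^ 2 * volume.real (simplex s) := by
    refine (le_abs_self _).trans (norm_setIntegral_le_of_norm_le_const
      (volume_simplex_lt_top s) fun x hx =>
        norm_le_on_simplex (interp_mem fun y => (⟪φ y, φ y⟫ : ℝ)) hs ?_ hx)
    intro y hy
    rw [interp_apply _ (T.mem_nodes_of_cell hs hy), real_inner_self_eq_norm_sq, norm_pow, norm_norm]
    gcongr
    exact hmax y hy
  have hlow := le_setIntegral_of_homothety (t := 1 / 4) (c := (1 / 2 * ‖φ z‖) ^ 2) (hint s hs)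
    (fun x _ => by positivity) hz (by norm_num) (by norm_num) (fun y hy => by
      rw [S1_homothety hφ hs hz hy (by norm_num) (by norm_num)]
      have h1 : ‖φ y‖ ≤ ‖φ z‖ := norm_le_on_simplex hφ hs hmax hy
      have h2 := norm_sub_le_norm_add ((1 - 1 / 4 : ℝ) • φ z) ((1 / 4 : ℝ) • φ y)
      rw [norm_smul, norm_smul] at h2
      norm_num at h2
      gcongr
      norm_num
      linarith)
  refine hup.trans ?_
  calc ‖φ z‖ ^ 2 * volume.real (simplex s)
      = 4 ^ (d + 1) * ((1 / 4) ^ d * (volume.real (simplex s) * (1 / 2 * ‖φ z‖) ^ 2)) := by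
        have : (4 : ℝ) ^ (d + 1) * (1 / 4) ^ d = 4 := by
          rw [pow_succ, mul_right_comm, ← mul_pow]; norm_num
        linear_combination (-(1 / 4) * volume.real (simplex s) * ‖φ z‖ ^ 2) * this
    _ ≤ _ := by gcongr

/-! ### The gradient -/

section Grad

variable {T}

theorem hasFDerivAt_of_eqOn {V : Type*} [NormedAddCommGroup V] [NormedSpace ℝ V]
    {u : Rd d → V} {A : Rd d →ᵃ[ℝ] V} {s : Finset (Rd d)}
    (hA : Set.EqOn u A (simplex s)) {x : Rd d} (hx : x ∈ interior (simplex s)) :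
    HasFDerivAt u (LinearMap.toContinuousLinearMap A.linear) x := by
  have h1 : HasFDerivAt (fun y => LinearMap.toContinuousLinearMap A.linear y + A 0)
      (LinearMap.toContinuousLinearMap A.linear) x :=
    (ContinuousLinearMap.hasFDerivAt _).add_const _
  refine h1.congr_of_eventuallyEq ?_
  filter_upwards [mem_interior_iff_mem_nhds.1 hx] with y hy
  rw [hA hy]
  simpa using congrFun A.decomp y

theorem pd_eq_of_interior {u : Rd d → R3} (hu : u ∈ T.S1 R3) {s : Finset (Rd d)}
    (hs : s ∈ T.cells) {x y : Rd d} (hx : x ∈ interior (simplex s))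
    (hy : y ∈ interior (simplex s)) (a : Fin d) : pd a u x = pd a u y := by
  obtain ⟨A, hA⟩ := hu.2.1 s hs
  rw [pd, pd, (hasFDerivAt_of_eqOn hA hx).fderiv, (hasFDerivAt_of_eqOn hA hy).fderiv]

theorem differentiableAt_S1 {u : Rd d → R3} (hu : u ∈ T.S1 R3) {s : Finset (Rd d)}
    (hs : s ∈ T.cells) {x : Rd d} (hx : x ∈ interior (simplex s)) : DifferentiableAt ℝ u x := by
  obtain ⟨A, hA⟩ := hu.2.1 s hs
  exact (hasFDerivAt_of_eqOn hA hx).differentiableAt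

variable (T) in
/-- An interior point of an element, at which gradients of piecewise affine functions are
evaluated. -/
noncomputable def center (s : T.cells) : Rd d := (T.interior_simplex_nonempty s.2).choose

variable (T) in
theorem center_mem (s : T.cells) : T.center s ∈ interior (simplex (s : Finset (Rd d))) :=
  (T.interior_simplex_nonempty s.2).choose_spec

theorem gradInner_eq_sum (hΩ : IsLipschitzDomain Ω) {u v : Rd d → R3} (hu : u ∈ T.S1 R3)
    (hv : v ∈ T.S1 R3) :
    gradInner Ω u v = ∑ s : T.cells, volume.real (simplex (s : Finset (Rd d)))
      * ∑ a, ⟪pd a u (T.center s), pd a v (T.center s)⟫ := by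
  have hae : ∀ s : T.cells, ∀ᵐ x ∂(volume.restrict (simplex (s : Finset (Rd d)))),
      ∑ a, ⟪pd a u x, pd a v x⟫ = ∑ a, ⟪pd a u (T.center s), pd a v (T.center s)⟫ := fun s =>
    (ae_simplex_mem_interior _).mono fun x hx => by
      simp only [pd_eq_of_interior hu s.2 hx (T.center_mem s),
        pd_eq_of_interior hv s.2 hx (T.center_mem s)]
  rw [gradInner, T.setIntegral_eq_sum hΩ]
  · refine Finset.sum_congr rfl fun s _ => ?_
    rw [integral_congr_ae (hae s), setIntegral_const, smul_eq_mul]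
  · intro s hs
    exact (integrable_congr (hae ⟨s, hs⟩)).2 (integrableOn_const (volume_simplex_lt_top s).ne)

theorem pd_add {u v : Rd d → R3} (hu : u ∈ T.S1 R3) (hv : v ∈ T.S1 R3) (s : T.cells) (a : Fin d) :
    pd a (u + v) (T.center s) = pd a u (T.center s) + pd a v (T.center s) := by
  rw [pd, fderiv_add (differentiableAt_S1 hu s.2 (T.center_mem s))
    (differentiableAt_S1 hv s.2 (T.center_mem s))]
  rfl

theorem pd_smul {u : Rd d → R3} (hu : u ∈ T.S1 R3) (c : ℝ) (s : T.cells) (a : Fin d) :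
    pd a (c • u) (T.center s) = c • pd a u (T.center s) := by
  rw [pd, fderiv_const_smul (differentiableAt_S1 hu s.2 (T.center_mem s))]
  rfl

theorem gradInner_self_nonneg (u : Rd d → R3) : 0 ≤ gradInner Ω u u :=
  integral_nonneg fun _ => Finset.sum_nonneg fun _ _ => real_inner_self_nonneg

theorem gradInner_comm (u v : Rd d → R3) : gradInner Ω u v = gradInner Ω v u := by
  simp only [gradInner, real_inner_comm]

theorem gradInner_add_right (hΩ : IsLipschitzDomain Ω) {u v w : Rd d → R3} (hu : u ∈ T.S1 R3)
    (hv : v ∈ T.S1 R3) (hw : w ∈ T.S1 R3) :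
    gradInner Ω u (v + w) = gradInner Ω u v + gradInner Ω u w := by
  rw [gradInner_eq_sum hΩ hu (Submodule.add_mem _ hv hw), gradInner_eq_sum hΩ hu hv,
    gradInner_eq_sum hΩ hu hw, ← Finset.sum_add_distrib]
  refine Finset.sum_congr rfl fun s _ => ?_
  simp only [pd_add hv hw, inner_add_right, Finset.sum_add_distrib, mul_add]

theorem gradInner_smul_right (hΩ : IsLipschitzDomain Ω) {u v : Rd d → R3} (hu : u ∈ T.S1 R3)
    (hv : v ∈ T.S1 R3) (c : ℝ) :
    gradInner Ω u (c • v) = c * gradInner Ω u v := by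
  rw [gradInner_eq_sum hΩ hu (Submodule.smul_mem _ c hv), gradInner_eq_sum hΩ hu hv,
    Finset.mul_sum]
  refine Finset.sum_congr rfl fun s _ => ?_
  simp only [pd_smul hv, real_inner_smul_right, ← Finset.mul_sum]
  ring

theorem hmin_le {s : Finset (Rd d)} (hs : s ∈ T.cells) : T.hmin ≤ Metric.diam (simplex s) :=
  csInf_le (T.cells_finite.image _).bddBelow ⟨s, hs, rfl⟩

/-- The derivative of a piecewise affine function on an element, by means of a ball inscribed in
the element: the difference quotient across the ball is bounded by the nodal values. -/
theorem norm_pd_le {φ : Rd d → R3} (hφ : φ ∈ T.S1 R3) {s : Finset (Rd d)} (hs : s ∈ T.cells)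
    {c : ℝ} (hc : ∀ z ∈ s, ‖φ z‖ ≤ c) {x : Rd d} {r : ℝ} (hr : 0 < r)
    (hball : Metric.closedBall x r ⊆ simplex s) {y : Rd d} (hy : y ∈ interior (simplex s))
    (a : Fin d) : ‖pd a φ y‖ * r ≤ c := by
  obtain ⟨A, hA⟩ := hφ.2.1 s hs
  have hbd : ∀ v ∈ simplex s, ‖A v‖ ≤ c := fun v hv => by
    rw [← hA hv]; exact norm_le_on_simplex hφ hs hc hv
  have h1 := hbd _ (hball (show x + r • EuclideanSpace.single a (1 : ℝ) ∈ _ by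
    simp [norm_smul, abs_of_pos hr]))
  have h2 := hbd _ (hball (show x - r • EuclideanSpace.single a (1 : ℝ) ∈ _ by
    simp [norm_smul, abs_of_pos hr, sub_eq_add_neg]))
  have h3 : (2 * r) • pd a φ y = A (x + r • EuclideanSpace.single a (1 : ℝ))
      - A (x - r • EuclideanSpace.single a (1 : ℝ)) := by
    rw [← vsub_eq_sub, ← AffineMap.linearMap_vsub, pd, (hasFDerivAt_of_eqOn hA hy).fderiv,
      LinearMap.coe_toContinuousLinearMap', ← map_smul]
    congr 1
    rw [vsub_eq_sub]
    module
  have h4 := norm_sub_le (A (x + r • EuclideanSpace.single a (1 : ℝ)))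
    (A (x - r • EuclideanSpace.single a (1 : ℝ)))
  rw [← h3, norm_smul, Real.norm_of_nonneg (by positivity)] at h4
  linarith

/-- The inverse estimate on shape-regular meshes. -/
theorem hmin_sq_mul_gradInner_le (hΩ : IsLipschitzDomain Ω) {κ : ℝ} (hκ : T.ShapeRegular κ)
    (hmin : 0 ≤ T.hmin) {φ : Rd d → R3} (hφ : φ ∈ T.S1 R3) :
    T.hmin ^ 2 * gradInner Ω φ φ ≤ (d * (2 * κ) ^ 2 * 2 ^ (d + 1)) * T.lump φ φ := by
  rw [gradInner_eq_sum hΩ hφ hφ, T.lump_self_eq_sum_setIntegral hΩ, Finset.mul_sum, Finset.mul_sum]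
  refine Finset.sum_le_sum ?_
  rintro ⟨s, hs⟩ -
  obtain ⟨z, hz, hmax⟩ := s.exists_max_image (fun z => ‖φ z‖) (T.nonempty_of_cell hs)
  obtain ⟨x, r, hr, hball, hdiam⟩ := hκ s hs
  have hpd : ∀ a : Fin d, T.hmin ^ 2 *
      ⟪pd a φ (T.center ⟨s, hs⟩), pd a φ (T.center ⟨s, hs⟩)⟫ ≤ (2 * κ) ^ 2 * ‖φ z‖ ^ 2 := by
    intro a
    have h1 := norm_pd_le hφ hs hmax hr hball (T.center_mem ⟨s, hs⟩) a
    have h2 : T.hmin ≤ 2 * κ * r := by linarith [hmin_le hs]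
    have h3 : T.hmin * ‖pd a φ (T.center ⟨s, hs⟩)‖ ≤ 2 * κ * ‖φ z‖ := by
      have hκ0 : 0 ≤ 2 * κ := by
        by_contra! hneg
        linarith [mul_neg_of_neg_of_pos hneg hr]
      calc T.hmin * ‖pd a φ (T.center ⟨s, hs⟩)‖ ≤ 2 * κ * r * ‖pd a φ (T.center ⟨s, hs⟩)‖ := by
            gcongr
        _ = 2 * κ * (‖pd a φ (T.center ⟨s, hs⟩)‖ * r) := by ring
        _ ≤ _ := by gcongr
    rw [real_inner_self_eq_norm_sq, ← mul_pow, ← mul_pow]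
    gcongr
  have hlow := le_setIntegral_S1 (interp_mem (T := T) (fun y => ⟪φ y, φ y⟫)) hs (fun y hy => by
    rw [interp_apply _ (T.mem_nodes_of_cell hs hy)]; exact real_inner_self_nonneg) hz
  rw [interp_apply _ (T.mem_nodes_of_cell hs hz), real_inner_self_eq_norm_sq] at hlow
  have hvol := T.volume_simplex_pos hs
  have h2d : (2 : ℝ) ^ (d + 1) * (1 / 2) ^ (d + 1) = 1 := by rw [← mul_pow]; norm_num
  calc T.hmin ^ 2 * (volume.real (simplex s) * ∑ a, ⟪pd a φ (T.center ⟨s, hs⟩),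
        pd a φ (T.center ⟨s, hs⟩)⟫)
      = volume.real (simplex s) * ∑ a, T.hmin ^ 2 * ⟪pd a φ (T.center ⟨s, hs⟩),
        pd a φ (T.center ⟨s, hs⟩)⟫ := by rw [← Finset.mul_sum]; ring
    _ ≤ volume.real (simplex s) * ∑ _a : Fin d, (2 * κ) ^ 2 * ‖φ z‖ ^ 2 := by
        exact mul_le_mul_of_nonneg_left (Finset.sum_le_sum fun a _ => hpd a) hvol.le
    _ = (d * (2 * κ) ^ 2 * 2 ^ (d + 1))
        * ((1 / 2) ^ (d + 1) * (volume.real (simplex s) * ‖φ z‖ ^ 2)) := by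
        rw [Finset.sum_const, Finset.card_univ, Fintype.card_fin, nsmul_eq_mul]
        linear_combination (-(volume.real (simplex s) * d * (2 * κ) ^ 2 * ‖φ z‖ ^ 2)) * h2d
    _ ≤ _ := by gcongr

theorem memLp_pd (hΩ : IsLipschitzDomain Ω) {u : Rd d → R3} (hu : u ∈ T.S1 R3) (a : Fin d) :
    MemLp (pd a u) 2 (volume.restrict Ω) := by
  have : IsFiniteMeasure (volume.restrict Ω) := ⟨by
    rw [Measure.restrict_apply_univ]; exact hΩ.isBounded.measure_lt_top⟩
  refine MemLp.of_bound (measurable_fderiv_apply_const ℝ u _).aestronglyMeasurable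
    (∑ s : T.cells, ‖pd a u (T.center s)‖) (T.ae_of_forall_interior hΩ fun s hs x hx => ?_)
  rw [pd_eq_of_interior hu hs hx (T.center_mem ⟨s, hs⟩)]
  exact Finset.single_le_sum (f := fun s : T.cells => ‖pd a u (T.center s)‖)
    (fun _ _ => norm_nonneg _) (Finset.mem_univ _)

theorem memLp_S1 (hΩ : IsLipschitzDomain Ω) {u : Rd d → R3} (hu : u ∈ T.S1 R3) :
    MemLp u 2 (volume.restrict Ω) := by
  refine (memLp_two_iff_integrable_sq_norm (integrableOn_S1 hΩ hu).aestronglyMeasurable).2 ?_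
  exact (T.integrableOn_iff hΩ).2 fun s hs =>
    ((continuousOn_simplex hu hs).norm.pow 2).integrableOn_compact (isCompact_simplex _)

end Grad

end Mesh

/-! ### The vector product -/

theorem inner_R3 (a b : R3) : ⟪a, b⟫ = a 0 * b 0 + a 1 * b 1 + a 2 * b 2 := by
  simp [PiLp.inner_apply, Fin.sum_univ_three, mul_comm]

theorem cross_zero_coord (a b : R3) : cross a b 0 = a 1 * b 2 - a 2 * b 1 := by
  simp [cross, cross_apply]

theorem cross_one_coord (a b : R3) : cross a b 1 = a 2 * b 0 - a 0 * b 2 := by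
  simp [cross, cross_apply]

theorem cross_two_coord (a b : R3) : cross a b 2 = a 0 * b 1 - a 1 * b 0 := by
  simp [cross, cross_apply]

/-- The vector product with a fixed vector is skew-adjoint. -/
theorem inner_cross_skew (a b c : R3) : ⟪cross a b, c⟫ = -⟪b, cross a c⟫ := by
  simp only [inner_R3, cross_zero_coord, cross_one_coord, cross_two_coord]
  ring

theorem inner_cross_self_right (a b : R3) : ⟪cross a b, b⟫ = 0 := by
  simp only [inner_R3, cross_zero_coord, cross_one_coord, cross_two_coord]
  ring

theorem inner_cross_self_left (a b : R3) : ⟪cross a b, a⟫ = 0 := by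
  simp only [inner_R3, cross_zero_coord, cross_one_coord, cross_two_coord]
  ring

theorem cross_sub_right (a b c : R3) : cross a (b - c) = cross a b - cross a c := by
  simp [cross]

theorem norm_cross_le (a b : R3) : ‖cross a b‖ ≤ ‖a‖ * ‖b‖ := by
  refine le_of_sq_le_sq ?_ (by positivity)
  have lagrange : ⟪cross a b, cross a b⟫ + ⟪a, b⟫ ^ 2 = ⟪a, a⟫ * ⟪b, b⟫ := by
    simp only [inner_R3, cross_zero_coord, cross_one_coord, cross_two_coord]
    ring
  simp only [real_inner_self_eq_norm_sq] at lagrange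
  rw [mul_pow]
  nlinarith [sq_nonneg (⟪a, b⟫ : ℝ)]

namespace Mesh

/-! ### Identities for the mass-lumped product and the gradient form -/

variable {d : ℕ} {Ω : Set (Rd d)} {T : Mesh Ω}

/-- A field is determined at the nodes by its mass-lumped products with the test functions. -/
theorem eq_of_lump_eq (hΩ : IsLipschitzDomain Ω) {a b : Rd d → R3}
    (h : ∀ φ ∈ T.S1 R3, T.lump a φ = T.lump b φ) {z : Rd d} (hz : z ∈ T.nodes) : a z = b z := by
  classical
  have htest : ∀ f : Rd d → R3, T.lump f (fun x => T.hat z x • (a z - b z))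
      = T.weight z * ⟪f z, a z - b z⟫ := by
    intro f
    rw [T.lump_eq_sum hΩ, Finset.sum_eq_single_of_mem z hz]
    · rw [T.hat_apply z hz, if_pos rfl, one_smul]
    · intro y hy hyz
      rw [T.hat_apply z hy, if_neg hyz, zero_smul, inner_zero_right, mul_zero]
  have h1 := h _ (smul_hat_mem z (a z - b z))
  rw [htest, htest] at h1
  have h2 := mul_left_cancel₀ (T.weight_pos hΩ hz).ne' h1
  rw [← sub_eq_zero, ← inner_sub_left, inner_self_eq_zero, sub_eq_zero] at h2
  exact h2

theorem gradInner_add_smul_self (hΩ : IsLipschitzDomain Ω) {u v : Rd d → R3} (hu : u ∈ T.S1 R3)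
    (hv : v ∈ T.S1 R3) (c : ℝ) :
    gradInner Ω (u + c • v) (u + c • v)
      = gradInner Ω u u + 2 * c * gradInner Ω u v + c ^ 2 * gradInner Ω v v := by
  have hcv := Submodule.smul_mem _ c hv
  rw [gradInner_add_right hΩ (Submodule.add_mem _ hu hcv) hu hcv, gradInner_comm _ u,
    gradInner_comm _ (c • v), gradInner_add_right hΩ hu hu hcv, gradInner_add_right hΩ hcv hu hcv,
    gradInner_comm (c • v) u]
  rw [gradInner_smul_right hΩ hu hv, gradInner_smul_right hΩ hcv hv, gradInner_comm (c • v) v,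
    gradInner_smul_right hΩ hv hv]
  ring

theorem gradInner_le_young (hΩ : IsLipschitzDomain Ω) {u v : Rd d → R3} (hu : u ∈ T.S1 R3)
    (hv : v ∈ T.S1 R3) : gradInner Ω u v ≤ 1 / 4 * gradInner Ω u u + gradInner Ω v v := by
  have h1 := gradInner_self_nonneg (Ω := Ω) (u + (-2 : ℝ) • v)
  rw [gradInner_add_smul_self hΩ hu hv] at h1
  linarith

theorem lump_le_young (hΩ : IsLipschitzDomain Ω) (φ ψ : Rd d → R3) :
    T.lump φ ψ ≤ 1 / 2 * T.lump φ φ + 1 / 2 * T.lump ψ ψ := by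
  simp only [T.lump_eq_sum hΩ, Finset.mul_sum, ← Finset.sum_add_distrib]
  refine Finset.sum_le_sum fun z hz => ?_
  have h1 : (0 : ℝ) ≤ ⟪φ z - ψ z, φ z - ψ z⟫ := real_inner_self_nonneg
  rw [inner_sub_sub_self, real_inner_comm (φ z) (ψ z)] at h1
  have h2 := (T.weight_pos hΩ hz).le
  nlinarith [mul_nonneg h2 h1]

/-! ### The inner iteration -/

section InnerStep

variable {α τ k : ℝ} {m w u z u' z' : Rd d → R3}

/-- The nodal form of the first equation of the inner iteration. -/
theorem InnerStep.two_smul_eq (hΩ : IsLipschitzDomain Ω) (h : T.InnerStep α τ k m w u z u' z')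
    {y : Rd d} (hy : y ∈ T.nodes) : (2 : ℝ) • m y = (2 : ℝ) • u' y + k • cross (u' y) (z y) := by
  refine (eq_of_lump_eq hΩ (a := fun y => (2 : ℝ) • u' y + k • cross (u' y) (z y))
    (b := fun y => (2 : ℝ) • m y) (fun φ hφ => ?_) hy).symm
  have h1 := h.u_eq φ hφ
  simp only [T.lump_eq_sum hΩ, Finset.mul_sum, ← Finset.sum_add_distrib] at h1 ⊢
  convert h1 using 2 with y hy y hy
  · rw [inner_add_left, real_inner_smul_left, real_inner_smul_left]; ring
  · rw [real_inner_smul_left]; ring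

/-- Consequently `u'` is orthogonal to `u' - m`, so that the extrapolation `2 u' - m` is the
reflection of `m` in the line of `u'` and keeps the length of `m`. -/
theorem InnerStep.inner_eq (hΩ : IsLipschitzDomain Ω) (h : T.InnerStep α τ k m w u z u' z')
    {y : Rd d} (hy : y ∈ T.nodes) : ⟪m y, u' y⟫ = ‖u' y‖ ^ 2 := by
  have h1 := congrArg (fun v => (⟪v, u' y⟫ : ℝ)) (h.two_smul_eq hΩ hy)
  simp only [inner_add_left, real_inner_smul_left, inner_cross_self_left,
    real_inner_self_eq_norm_sq] at h1
  linarith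

theorem InnerStep.norm_le (hΩ : IsLipschitzDomain Ω) (h : T.InnerStep α τ k m w u z u' z')
    {y : Rd d} (hy : y ∈ T.nodes) : ‖u' y‖ ≤ ‖m y‖ := by
  have h1 := real_inner_le_norm (m y) (u' y)
  rw [h.inner_eq hΩ hy] at h1
  by_contra! hlt
  have : 0 < ‖u' y‖ := (norm_nonneg _).trans_lt hlt
  nlinarith

theorem InnerStep.norm_extrapolation (hΩ : IsLipschitzDomain Ω)
    (h : T.InnerStep α τ k m w u z u' z') {y : Rd d} (hy : y ∈ T.nodes) :
    ‖(2 : ℝ) • u' y - m y‖ = ‖m y‖ := by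
  have h1 : ‖(2 : ℝ) • u' y - m y‖ ^ 2 = ‖m y‖ ^ 2 := by
    rw [norm_sub_sq_real, real_inner_smul_left, real_inner_comm, h.inner_eq hΩ hy, norm_smul]
    norm_num
    ring
  exact (sq_eq_sq₀ (norm_nonneg _) (norm_nonneg _)).1 h1

theorem InnerStep.quotient_eq (hΩ : IsLipschitzDomain Ω) (hk : 0 < k)
    (h : T.InnerStep α τ k m w u z u' z') {y : Rd d} (hy : y ∈ T.nodes) :
    k⁻¹ • (((2 : ℝ) • u' - m) y - m y) = -cross (u' y) (z y) := by
  have h1 := h.two_smul_eq hΩ hy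
  have h2 : ((2 : ℝ) • u' - m) y - m y = -(k • cross (u' y) (z y)) := by
    have : ((2 : ℝ) • u' - m) y - m y = (2 : ℝ) • u' y - (2 : ℝ) • m y := by
      simp only [Pi.sub_apply, Pi.smul_apply]; module
    rw [this, h1]; abel
  rw [h2, smul_neg, inv_smul_smul₀ hk.ne']

/-- The discrete energy law of a time step. The iterates enter the first equation with the
explicit iterate `z` in place of `z'`; this is the source of the two terms on the right-hand side,
which contain the increment `z' - z`. -/
theorem InnerStep.energy_eq (hΩ : IsLipschitzDomain Ω) (hk : 0 < k) (hm : m ∈ T.S1 R3)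
    (h : T.InnerStep α τ k m w u z u' z') {m' w' D φ : Rd d → R3}
    (hm' : m' = (2 : ℝ) • u' - m) (hw' : w' = (2 : ℝ) • z' - w) (hD : D = k⁻¹ • (m' - m))
    (hφ : φ = T.interp fun x => cross (u' x) (z' x - z x)) :
    1 / 2 * gradInner Ω m' m' + τ / 2 * T.lump w' w' + α * k * T.lump D D
      = 1 / 2 * gradInner Ω m m + τ / 2 * T.lump w w
        + k * (gradInner Ω u' φ + α * T.lump D φ) := by
  obtain ⟨g, hg, hz⟩ := h.z_eq
  have hu := h.u_mem
  have hDm : D ∈ T.S1 R3 := by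
    rw [hD, hm']
    exact Submodule.smul_mem _ _ (Submodule.sub_mem _
      (Submodule.sub_mem _ (Submodule.smul_mem _ _ hu) hm) hm)
  have hφm : φ ∈ T.S1 R3 := hφ ▸ interp_mem _
  have hDy : ∀ y ∈ T.nodes, cross (u' y) (z' y) = φ y - D y := fun y hy => by
    have h1 : D y = -cross (u' y) (z y) := by
      rw [← h.quotient_eq hΩ hk hy, hD, hm']; rfl
    rw [h1, hφ, interp_apply _ hy, cross_sub_right]; abel
  have hmu : m = u' + (-(k / 2)) • D := by
    rw [hD, hm', smul_smul, show -(k / 2) * k⁻¹ = -(1 / 2) by field_simp]; module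
  have hmu' : m' = u' + (k / 2) • D := by
    rw [hD, hm', smul_smul, show k / 2 * k⁻¹ = 1 / 2 by field_simp]; module
  -- The exchange term: `(u × g) · z' = -g · (u × z')`.
  have hexchange : T.lump (fun x => cross (u' x) (g x)) z' = T.lump g D - T.lump g φ := by
    simp only [T.lump_eq_sum hΩ, ← Finset.sum_sub_distrib]
    refine Finset.sum_congr rfl fun y hy => ?_
    rw [inner_cross_skew, hDy y hy, inner_sub_right]; ring
  -- The damping term: `u × m = -(k / 2) u × D`.
  have hdamping : 2 * T.lump (fun x => cross (u' x) (m x)) z'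
      = k * T.lump D φ - k * T.lump D D := by
    simp only [T.lump_eq_sum hΩ, Finset.mul_sum, ← Finset.sum_sub_distrib]
    refine Finset.sum_congr rfl fun y hy => ?_
    have h1 : m y = u' y + (-(k / 2)) • D y := congrFun hmu y
    have h2 : (⟪m y, φ y - D y⟫ : ℝ) = -(k / 2) * ⟪D y, φ y - D y⟫ := by
      rw [h1, inner_add_left, real_inner_smul_left, ← hDy y hy,
        real_inner_comm, inner_cross_self_left, zero_add]
    rw [inner_cross_skew, hDy y hy, h2, inner_sub_right]; ring
  have hself : T.lump (fun x => cross (u' x) (z' x)) z' = 0 := by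
    simp only [T.lump_eq_sum hΩ, inner_cross_self_right, mul_zero, Finset.sum_const_zero]
  have hkinetic : 4 * T.lump z' z' - 4 * T.lump w z' = T.lump w' w' - T.lump w w := by
    simp only [T.lump_eq_sum hΩ, Finset.mul_sum, ← Finset.sum_sub_distrib]
    refine Finset.sum_congr rfl fun y _ => ?_
    have h1 : w' y = (2 : ℝ) • z' y - w y := congrFun hw' y
    rw [h1, inner_sub_sub_self, real_inner_smul_left, real_inner_smul_right, real_inner_smul_left,
      real_inner_smul_right, real_inner_comm (w y) (z' y)]
    ring
  have hgrad : gradInner Ω m' m' - gradInner Ω m m = 2 * k * gradInner Ω u' D := by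
    have h1 := gradInner_add_smul_self hΩ hu hDm (k / 2)
    have h2 := gradInner_add_smul_self hΩ hu hDm (-(k / 2))
    rw [← hmu'] at h1
    rw [← hmu] at h2
    rw [h1, h2]
    ring
  have h1 := hz z' h.z_mem
  rw [hexchange, hself, hg.2 D hDm, hg.2 φ hφm] at h1
  linear_combination h1 + (τ / 2) * (-hkinetic) + α * hdamping + (1 / 2) * hgrad

end InnerStep

/-! ### Positivity of the mesh sizes -/

theorem diam_simplex_pos (hd : 1 ≤ d) {s : Finset (Rd d)} (hs : s ∈ T.cells) :
    0 < Metric.diam (simplex s) := by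
  obtain ⟨x, hx, y, hy, hxy⟩ := Finset.one_lt_card.1 (show 1 < s.card by rw [hs.2]; omega)
  exact (dist_pos.2 hxy).trans_le (Metric.dist_le_diam_of_mem (isCompact_simplex s).isBounded
    (subset_convexHull ℝ _ hx) (subset_convexHull ℝ _ hy))

theorem cells_nonempty (hΩ : IsLipschitzDomain Ω) (T : Mesh Ω) : T.cells.Nonempty := by
  obtain ⟨x, hx⟩ := hΩ.isConnected.nonempty
  obtain ⟨s, hs, -⟩ := T.exists_cell (subset_closure hx)
  exact ⟨s, hs⟩

theorem hmin_pos (hΩ : IsLipschitzDomain Ω) (hd : 1 ≤ d) (T : Mesh Ω) : 0 < T.hmin := by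
  obtain ⟨s, hs, h⟩ := ((cells_nonempty hΩ T).image
    fun s : Finset (Rd d) => Metric.diam (simplex s)).csInf_mem (T.cells_finite.image _)
  rw [hmin, ← h]
  exact diam_simplex_pos hd hs

theorem h_pos (hΩ : IsLipschitzDomain Ω) (hd : 1 ≤ d) (T : Mesh Ω) : 0 < T.h := by
  obtain ⟨s, hs⟩ := cells_nonempty hΩ T
  exact (diam_simplex_pos hd hs).trans_le
    (le_csSup (T.cells_finite.image _).bddAbove ⟨s, hs, rfl⟩)

/-! ### The energy inequality -/

/-- The discrete energy: exchange energy and kinetic energy. -/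
noncomputable def energy (T : Mesh Ω) (τ : ℝ) (m w : Rd d → R3) : ℝ :=
  1 / 2 * gradInner Ω m m + τ / 2 * T.lump w w

theorem energy_nonneg (hΩ : IsLipschitzDomain Ω) {τ : ℝ} (hτ : 0 < τ) (m w : Rd d → R3) :
    0 ≤ T.energy τ m w := by
  have h1 := gradInner_self_nonneg (Ω := Ω) m
  have h2 := T.lump_self_nonneg hΩ w
  unfold energy
  positivity

theorem TimeStep.adm {α τ k ε : ℝ} {m w m' w' : Rd d → R3} (hΩ : IsLipschitzDomain Ω)
    (hm : m ∈ T.Adm) (h : T.TimeStep α τ k ε m w m' w') : m' ∈ T.Adm := by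
  obtain ⟨n, u, z, -, -, hin, -, -, rfl, -⟩ := h
  have hn := hin n le_rfl
  exact ⟨Submodule.sub_mem _ (Submodule.smul_mem _ _ hn.u_mem) hm.1, fun y hy =>
    (hn.norm_extrapolation hΩ hy).trans (hm.2 y hy)⟩

/-- The energy law with the perturbation estimated. The gradient term is bounded by means of the
inverse estimate, in which the factor `1 / hmin` is compensated by the tolerance `ε ≤ M hmin`. -/
theorem TimeStep.energy_le {α τ k ε κ M : ℝ} {m w m' w' : Rd d → R3} (hΩ : IsLipschitzDomain Ω)
    (hd : 1 ≤ d) (hα : 0 < α) (hτ : 0 < τ) (hk : 0 < k) (hε1 : ε ≤ 1)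
    (hεM : ε ≤ M * T.hmin) (hκ : T.ShapeRegular κ) (hm : m ∈ T.Adm)
    (h : T.TimeStep α τ k ε m w m' w') :
    T.energy τ m' w' + α / 2 * k * T.lumpNorm (k⁻¹ • (m' - m)) ^ 2
      ≤ T.energy τ m w + k / 4 * (T.energy τ m w + T.energy τ m' w')
        + k * ((d * (2 * κ) ^ 2 * 2 ^ (d + 1)) * M ^ 2 + α / 2) := by
  have hm'S := (h.adm hΩ hm).1
  obtain ⟨n, u, z, -, -, hin, hcrit, -, hm', hw'⟩ := h
  have hn := hin n le_rfl
  set φ := T.interp fun x => cross (u (n + 1) x) (z (n + 1) x - z n x) with hφ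
  have hφm : φ ∈ T.S1 R3 := interp_mem _
  set D := k⁻¹ • (m' - m) with hD
  have hDm : D ∈ T.S1 R3 := Submodule.smul_mem _ _ (Submodule.sub_mem _ hm'S hm.1)
  have hE := hn.energy_eq hΩ hk hm.1 hm' hw' hD hφ
  have hδ : T.lumpNorm (z (n + 1) - z n) ≤ ε := by
    have h1 : 0 ≤ T.lumpNorm (u (n + 1) - u n) := Real.sqrt_nonneg _
    have h2 : _ ≤ ε := hcrit
    linarith
  have hδ0 : 0 ≤ T.lumpNorm (z (n + 1) - z n) := Real.sqrt_nonneg _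
  have hφδ : T.lump φ φ ≤ T.lumpNorm (z (n + 1) - z n) ^ 2 := by
    rw [T.lumpNorm_sq hΩ]
    refine T.lump_self_mono hΩ fun y hy => ?_
    rw [hφ, interp_apply _ hy]
    refine (norm_cross_le _ _).trans ?_
    have h1 : ‖u (n + 1) y‖ ≤ 1 := (hn.norm_le hΩ hy).trans_eq (hm.2 y hy)
    exact mul_le_of_le_one_left (norm_nonneg _) h1
  have hφ1 : T.lump φ φ ≤ 1 := hφδ.trans (pow_le_one₀ hδ0 (hδ.trans hε1))
  have hφM : gradInner Ω φ φ ≤ (d * (2 * κ) ^ 2 * 2 ^ (d + 1)) * M ^ 2 := by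
    have hmin := hmin_pos hΩ hd T
    have h1 := hmin_sq_mul_gradInner_le hΩ hκ hmin.le hφm
    have h2 : T.lump φ φ ≤ (M * T.hmin) ^ 2 :=
      hφδ.trans (pow_le_pow_left₀ hδ0 (hδ.trans hεM) 2)
    have h3 : (d * (2 * κ) ^ 2 * 2 ^ (d + 1)) * T.lump φ φ
        ≤ (d * (2 * κ) ^ 2 * 2 ^ (d + 1)) * (M * T.hmin) ^ 2 :=
      mul_le_mul_of_nonneg_left h2 (by positivity)
    refine le_of_mul_le_mul_left ?_ (pow_pos hmin 2)
    linarith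
  have hY1 := gradInner_le_young hΩ hn.u_mem hφm
  have hY2 := lump_le_young (T := T) hΩ D φ
  -- `u` is the midpoint of `m` and `m'`.
  have hmid : 2 * gradInner Ω (u (n + 1)) (u (n + 1)) ≤ gradInner Ω m m + gradInner Ω m' m' := by
    have h1 : m = u (n + 1) + (-(k / 2)) • D := by
      rw [hD, hm', smul_smul, show -(k / 2) * k⁻¹ = -(1 / 2) by field_simp]; module
    have h2 : m' = u (n + 1) + (k / 2) • D := by
      rw [hD, hm', smul_smul, show k / 2 * k⁻¹ = 1 / 2 by field_simp]; module
    have h3 := gradInner_add_smul_self hΩ hn.u_mem hDm (-(k / 2))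
    have h4 := gradInner_add_smul_self hΩ hn.u_mem hDm (k / 2)
    rw [← h1] at h3
    rw [← h2] at h4
    have h5 := mul_nonneg (sq_nonneg (k / 2)) (gradInner_self_nonneg (Ω := Ω) D)
    rw [neg_sq] at h3
    linarith
  have hw0 := T.lump_self_nonneg hΩ w
  have hw0' := T.lump_self_nonneg hΩ w'
  have hpert : gradInner Ω (u (n + 1)) φ + α * T.lump D φ
      ≤ 1 / 4 * (T.energy τ m w + T.energy τ m' w')
        + (d * (2 * κ) ^ 2 * 2 ^ (d + 1)) * M ^ 2 + α / 2 + α / 2 * T.lump D D := by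
    have h1 : α * T.lump D φ ≤ α * (1 / 2 * T.lump D D + 1 / 2) :=
      mul_le_mul_of_nonneg_left (by linarith) hα.le
    have h2 : 0 ≤ τ / 2 * T.lump w w := by positivity
    have h3 : 0 ≤ τ / 2 * T.lump w' w' := by positivity
    unfold energy
    linarith
  have := mul_le_mul_of_nonneg_left hpert hk.le
  rw [T.lumpNorm_sq hΩ]
  unfold energy at this ⊢
  linarith

end Mesh

/-! ### A discrete Gronwall inequality -/

/-- The right-hand side of the recursion contains the new value `E (i + 1)`; its factor `k / 4` is
small enough for a growth rate of at most `1`. -/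
theorem discrete_gronwall {E S : ℕ → ℝ} {k B : ℝ} (hk : 0 < k) (hk1 : k < 1) (hB : 0 ≤ B)
    (hE : ∀ i, 0 ≤ E i) (hS : ∀ i, 0 ≤ S i) {j : ℕ}
    (h : ∀ i < j, E (i + 1) + S i ≤ E i + k / 4 * (E i + E (i + 1)) + k * B) :
    E j + ∑ i ∈ Finset.range j, S i ≤ Real.exp (j * k) * (E 0 + 2 * B * (j * k)) := by
  induction j with
  | zero => simp
  | succ j ih =>
    have ih' := ih fun i hi => h i (by omega)
    have hstep := h j (by omega)
    set A := E j + ∑ i ∈ Finset.range j, S i with hA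
    set A' := E (j + 1) + ∑ i ∈ Finset.range (j + 1), S i with hA'
    have hsum : 0 ≤ ∑ i ∈ Finset.range j, S i := Finset.sum_nonneg fun i _ => hS i
    have hA0 : 0 ≤ A := add_nonneg (hE j) hsum
    have hrec : A' ≤ A + k / 4 * (A + A') + k * B := by
      have h1 : E j + E (j + 1) ≤ A + A' := by
        rw [hA, hA', Finset.sum_range_succ]
        linarith [hS j]
      have h2 := mul_le_mul_of_nonneg_left h1 (by positivity : 0 ≤ k / 4)
      rw [hA', Finset.sum_range_succ, ← add_assoc] at *
      linarith
    have hlin : A' ≤ (1 + k) * (A + 2 * k * B) := by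
      -- `(1 + k / 4) ≤ (1 - k / 4) (1 + k)` for `k ≤ 2`
      have h1 : 0 ≤ k * (2 - k) * A := mul_nonneg (mul_nonneg hk.le (by linarith)) hA0
      have h2 : 0 ≤ k * B * (1 + 3 / 2 * k - k ^ 2 / 2) :=
        mul_nonneg (mul_nonneg hk.le hB) (by nlinarith)
      refine le_of_mul_le_mul_left ?_ (by linarith : 0 < 1 - k / 4)
      nlinarith
    have hexp : 1 + k ≤ Real.exp k := by linarith [Real.add_one_le_exp k]
    have hj : 1 ≤ Real.exp (j * k) := Real.one_le_exp (by positivity)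
    have hsplit : Real.exp ((j + 1 : ℕ) * k) = Real.exp k * Real.exp (j * k) := by
      rw [← Real.exp_add]; congr 1; push_cast; ring
    have hkB : 0 ≤ 2 * k * B := by positivity
    calc A' ≤ (1 + k) * (A + 2 * k * B) := hlin
      _ ≤ Real.exp k * (A + 2 * k * B) := by gcongr
      _ ≤ Real.exp k * (Real.exp (j * k) * (E 0 + 2 * B * (j * k))
            + Real.exp (j * k) * (2 * k * B)) := by
          refine mul_le_mul_of_nonneg_left ?_ (Real.exp_pos k).le
          exact add_le_add ih' (le_mul_of_one_le_left hkB hj)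
      _ = _ := by rw [hsplit]; push_cast; ring

/-! ### Bounds for the initial data -/

theorem integrable_norm_sq {d : ℕ} {Ω : Set (Rd d)} {f : Rd d → R3}
    (hf : MemLp f 2 (volume.restrict Ω)) : Integrable (fun x => ‖f x‖ ^ 2) (volume.restrict Ω) :=
  (memLp_two_iff_integrable_sq_norm hf.aestronglyMeasurable).1 hf

theorem l2Norm_sq {d : ℕ} (Ω : Set (Rd d)) (f : Rd d → R3) :
    l2Norm Ω f ^ 2 = ∫ x in Ω, ‖f x‖ ^ 2 :=
  Real.sq_sqrt (integral_nonneg fun x => by positivity)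

theorem l2Norm_sq_le {d : ℕ} {Ω : Set (Rd d)} {f g : Rd d → R3}
    (hf : MemLp f 2 (volume.restrict Ω)) (hg : MemLp g 2 (volume.restrict Ω)) :
    l2Norm Ω f ^ 2 ≤ 2 * l2Norm Ω (f - g) ^ 2 + 2 * l2Norm Ω g ^ 2 := by
  have hfg := integrable_norm_sq (hf.sub hg)
  simp only [l2Norm_sq]
  rw [← integral_const_mul, ← integral_const_mul,
    ← integral_add (hfg.const_mul 2) ((integrable_norm_sq hg).const_mul 2)]
  refine integral_mono (integrable_norm_sq hf)
    ((hfg.const_mul 2).add ((integrable_norm_sq hg).const_mul 2)) fun x => ?_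
  have h1 : ‖f x‖ ≤ ‖(f - g) x‖ + ‖g x‖ := by
    simpa using norm_add_le ((f - g) x) (g x)
  have h2 : ‖f x‖ ^ 2 ≤ (‖(f - g) x‖ + ‖g x‖) ^ 2 := by gcongr
  change ‖f x‖ ^ 2 ≤ 2 * ‖(f - g) x‖ ^ 2 + 2 * ‖g x‖ ^ 2
  nlinarith [sq_nonneg (‖(f - g) x‖ - ‖g x‖)]

namespace Mesh

variable {d : ℕ} {Ω : Set (Rd d)} {T : Mesh Ω}

theorem gradInner_self_eq_sum_l2Norm (hΩ : IsLipschitzDomain Ω) {u : Rd d → R3}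
    (hu : u ∈ T.S1 R3) : gradInner Ω u u = ∑ a, l2Norm Ω (pd a u) ^ 2 := by
  simp only [gradInner, l2Norm_sq, real_inner_self_eq_norm_sq]
  exact integral_finsetSum _ fun a _ => integrable_norm_sq (memLp_pd hΩ hu a)

theorem gradInner_self_le_of_h1Dist_le (hΩ : IsLipschitzDomain Ω) {u m : Rd d → R3}
    {G : Fin d → Rd d → R3} (hu : u ∈ T.S1 R3) (hG : ∀ a, MemLp (G a) 2 (volume.restrict Ω))
    (hdist : h1Dist Ω u m G ≤ 1) : gradInner Ω u u ≤ 2 + 2 * ∑ a, l2Norm Ω (G a) ^ 2 := by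
  have h1 : ∑ a, l2Norm Ω (pd a u - G a) ^ 2 ≤ 1 := by
    have := (Real.sqrt_le_iff.1 hdist).2
    linarith [sq_nonneg (l2Norm Ω (u - m))]
  rw [gradInner_self_eq_sum_l2Norm hΩ hu]
  calc ∑ a, l2Norm Ω (pd a u) ^ 2
      ≤ ∑ a, (2 * l2Norm Ω (pd a u - G a) ^ 2 + 2 * l2Norm Ω (G a) ^ 2) :=
        Finset.sum_le_sum fun a _ => l2Norm_sq_le (memLp_pd hΩ hu a) (hG a)
    _ = 2 * ∑ a, l2Norm Ω (pd a u - G a) ^ 2 + 2 * ∑ a, l2Norm Ω (G a) ^ 2 := by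
        rw [Finset.sum_add_distrib, Finset.mul_sum, Finset.mul_sum]
    _ ≤ _ := by linarith

theorem lump_interp_cross_le (hΩ : IsLipschitzDomain Ω) {m v v0 : Rd d → R3} (hm : m ∈ T.Adm)
    (hv : v ∈ T.S1 R3) (hv0 : MemLp v0 2 (volume.restrict Ω)) (hdist : l2Norm Ω (v - v0) ≤ 1) :
    T.lump (T.interp fun x => cross (m x) (v x)) (T.interp fun x => cross (m x) (v x))
      ≤ 4 ^ (d + 1) * (2 + 2 * l2Norm Ω v0 ^ 2) := by
  have h1 : l2Norm Ω v ^ 2 ≤ 2 + 2 * l2Norm Ω v0 ^ 2 := by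
    have h2 := l2Norm_sq_le (memLp_S1 hΩ hv) hv0
    have h3 : l2Norm Ω (v - v0) ^ 2 ≤ 1 := pow_le_one₀ (Real.sqrt_nonneg _) hdist
    linarith
  calc _ ≤ T.lump v v := T.lump_self_mono hΩ fun z hz => by
        rw [interp_apply _ hz]
        exact (norm_cross_le _ _).trans_eq (by rw [hm.2 z hz, one_mul])
    _ ≤ 4 ^ (d + 1) * l2Norm Ω v ^ 2 := T.lump_self_le hΩ hv
    _ ≤ _ := by gcongr

end Mesh

end ILLG

/-! ### The stability estimate -/

theorem proposition5p1 (d : ℕ) (hd : d = 2 ∨ d = 3)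
    (Ω : Set (Rd d)) (hΩ : IsLipschitzDomain Ω)
    (α τ : ℝ) (hα : 0 < α) (hτ : 0 < τ)
    (m0 v0 : Rd d → R3) (G0 : Fin d → Rd d → R3)
    (hm0 : IsH1 Ω m0 G0) (hm0_sphere : ∀ᵐ x ∂(volume.restrict Ω), ‖m0 x‖ = 1)
    (hv0 : MemLp v0 2 (volume.restrict Ω))
    (hmv : ∀ᵐ x ∂(volume.restrict Ω), ⟪m0 x, v0 x⟫ = 0)
    (κ M : ℝ) :
    ∃ C k0 ε0 : ℝ, 0 < C ∧ 0 < k0 ∧ 0 < ε0 ∧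
      ∀ ρ : ℝ → ℝ, Tendsto ρ (𝓝[>] 0) (𝓝 0) →
      ∃ h0 : ℝ, 0 < h0 ∧
        ∀ T : Mesh Ω, T.ShapeRegular κ → T.h < h0 →
        ∀ mh vh : Rd d → R3, h1Dist Ω mh m0 G0 ≤ ρ T.h → l2Norm Ω (vh - v0) ≤ ρ T.h →
        ∀ k ε : ℝ, 0 < k → k < k0 → 0 < ε → ε < ε0 → ε ≤ M * T.hmin →
        ∀ (j : ℕ) (m w : ℕ → Rd d → R3), T.Generates α τ k ε mh vh j m w →
          gradNorm Ω (m j) ^ 2 + T.lumpNorm (w j) ^ 2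
              + k * ∑ i ∈ Finset.range j, T.lumpNorm (k⁻¹ • (m (i + 1) - m i)) ^ 2
            ≤ C * (1 + j * k) * Real.exp (j * k) := by
  have hd1 : 1 ≤ d := by omega
  -- `B` bounds the perturbation per unit of time, `E0` the initial energy, and `K` absorbs the
  -- weights of the three contributions to the energy.
  set B : ℝ := (d * (2 * κ) ^ 2 * 2 ^ (d + 1)) * M ^ 2 + α / 2 with hB
  set E0 : ℝ := 1 / 2 * (2 + 2 * ∑ a, l2Norm Ω (G0 a) ^ 2)
    + τ / 2 * (4 ^ (d + 1) * (2 + 2 * l2Norm Ω v0 ^ 2)) with hE0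
  set K : ℝ := 2 + 2 / τ + 2 / α with hK
  have hB0 : 0 < B := by positivity
  have hE00 : 0 < E0 := by positivity
  have hK0 : 0 < K := by positivity
  refine ⟨K * (E0 + 2 * B), 1, 1, by positivity, one_pos, one_pos, fun ρ hρ => ?_⟩
  -- Of `ρ` only `ρ h < 1` for small `h` is needed; this bounds the initial energy.
  obtain ⟨h0, hh0, hρ1⟩ := mem_nhdsGT_iff_exists_Ioo_subset.1
    (hρ.eventually (gt_mem_nhds one_pos))
  refine ⟨h0, hh0, fun T hκ hTh mh vh hmh hvh k ε hk hk1 hε hε1 hεM j m w hgen => ?_⟩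
  have hρT : ρ T.h < 1 := hρ1 ⟨Mesh.h_pos hΩ hd1 T, hTh⟩
  have hadm : ∀ i ≤ j, m i ∈ T.Adm := by
    intro i
    induction i with
    | zero => exact fun _ => hgen.m_zero ▸ hgen.adm
    | succ i ih => exact fun hi => (hgen.step i (by omega)).adm hΩ (ih (by omega))
  have hinit : T.energy τ (m 0) (w 0) ≤ E0 := by
    rw [hgen.m_zero, hgen.w_zero, Mesh.energy, hE0]
    have h1 := Mesh.gradInner_self_le_of_h1Dist_le hΩ hgen.adm.1 hm0.memLp_grad (hmh.trans hρT.le)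
    have h2 := Mesh.lump_interp_cross_le hΩ hgen.adm hgen.tangent.1 hv0 (hvh.trans hρT.le)
    gcongr
  have hgron := discrete_gronwall (E := fun i => T.energy τ (m i) (w i))
    (S := fun i => α / 2 * k * T.lumpNorm (k⁻¹ • (m (i + 1) - m i)) ^ 2) hk hk1 hB0.le
    (fun i => Mesh.energy_nonneg hΩ hτ _ _) (fun i => by positivity)
    (fun i hi => (hgen.step i hi).energy_le hΩ hd1 hα hτ hk hε1.le hεM hκ (hadm i hi.le))
  rw [← Finset.mul_sum] at hgron
  set S := ∑ i ∈ Finset.range j, T.lumpNorm (k⁻¹ • (m (i + 1) - m i)) ^ 2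
  have hS : 0 ≤ S := Finset.sum_nonneg fun i _ => sq_nonneg _
  have hG := Mesh.gradInner_self_nonneg (Ω := Ω) (m j)
  have hW := T.lump_self_nonneg hΩ (w j)
  rw [gradNorm, Real.sq_sqrt hG, T.lumpNorm_sq hΩ]
  have hτK : 1 ≤ K * (τ / 2) := by
    have : K * (τ / 2) = τ + 1 + τ / α := by rw [hK]; field_simp
    rw [this]
    have : 0 < τ / α := by positivity
    linarith
  have hαK : 1 ≤ K * (α / 2) := by
    have : K * (α / 2) = α + α / τ + 1 := by rw [hK]; field_simp
    rw [this]
    have : 0 < α / τ := by positivity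
    linarith
  have hhK : 1 ≤ K * (1 / 2) := by
    have h1 : 0 < 2 / τ := by positivity
    have h2 : 0 < 2 / α := by positivity
    linarith
  calc gradInner Ω (m j) (m j) + T.lump (w j) (w j) + k * S
      ≤ K * (1 / 2) * gradInner Ω (m j) (m j) + K * (τ / 2) * T.lump (w j) (w j)
        + K * (α / 2) * (k * S) :=
        add_le_add (add_le_add (le_mul_of_one_le_left hG hhK) (le_mul_of_one_le_left hW hτK))
          (le_mul_of_one_le_left (by positivity) hαK)
    _ = K * (T.energy τ (m j) (w j) + α / 2 * k * S) := by rw [Mesh.energy]; ring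
    _ ≤ K * (Real.exp (j * k) * (E0 + 2 * B * (j * k))) := by
        refine mul_le_mul_of_nonneg_left (hgron.trans ?_) hK0.le
        gcongr
    _ ≤ K * (Real.exp (j * k) * ((E0 + 2 * B) * (1 + j * k))) := by
        gcongr
        have : 0 ≤ E0 * (j * k) := by positivity
        linarith
    _ = K * (E0 + 2 * B) * (1 + j * k) * Real.exp (j * k) := by ring
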